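/- Let $n\ge 1$, let $1<p<\infty$, and let $\Omega\subset\mathbb{R}^n$ be a nonempty, open, bounded, convex set with boundary of class $C^2$. For $x\in\Omega$ let $\delta(x)=\min_{y\in\partial\Omega}|x-y|$, let $R_{in}=\sup_{x\in\Omega}\delta(x)$ be the in-radius of $\Omega$, and put $C_p=\left(\frac{p-1}{p}\right)^p$. Let $W_0^{1,p}(\Omega)$ be the closure of $C_c^\infty(\Omega)$ in the (real-valued) Sobolev space $W^{1,p}(\Omega)$. Then for every $u\in W_0^{1,p}(\Omega)$ the function $|u|^p/\delta^p$ is integrable on $\Omega$ and $$\int_\Omega |\nabla u(x)|^p\,dx \;\ge\; C_p\int_\Omega \frac{|u(x)|^p}{\delta(x)^p}\,dx + \frac{(p-1)\,C_p}{R_{in}^p}\,\|u\|_{L^p(\Omega)}^p .$$ The constant $C_p$ in front of the Hardy term is sharp: if $K\in\mathbb{R}$ is such that $\int_\Omega |\nabla u|^p\,dx \ge K\int_\Omega |u|^p/\delta^p\,dx$ for all $u\in W_0^{1,p}(\Omega)$, then $K\le C_p$. -/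

import Mathlib

open MeasureTheory
open scoped ContDiff

noncomputable section

/-- Euclidean space `ℝⁿ`. -/
abbrev Euc (n : ℕ) : Type := EuclideanSpace ℝ (Fin n)

/-- The boundary of `Ω` is of class `C²`: near every boundary point, `Ω` is the sublevel set
`{ρ < 0}` of a `C²` function `ρ` with nowhere vanishing differential (so that `∂Ω` is locally the
regular level set `{ρ = 0}` and `Ω` lies locally on one side of it). -/
def HasC2Boundary {n : ℕ} (Ω : Set (Euc n)) : Prop :=
  ∀ y ∈ frontier Ω, ∃ (U : Set (Euc n)) (ρ : Euc n → ℝ), IsOpen U ∧ y ∈ U ∧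
    ContDiffOn ℝ 2 ρ U ∧ (∀ x ∈ U, fderiv ℝ ρ x ≠ 0) ∧ (∀ x ∈ U, x ∈ Ω ↔ ρ x < 0)

/-- The test functions `C_c^∞(Ω)`. -/
def IsTestFunction {n : ℕ} (Ω : Set (Euc n)) (φ : Euc n → ℝ) : Prop :=
  ContDiff ℝ ∞ φ ∧ HasCompactSupport φ ∧ tsupport φ ⊆ Ω

/-- `g` is the weak (distributional) gradient of `u` on `Ω`. -/
def HasWeakGradient {n : ℕ} (Ω : Set (Euc n)) (u : Euc n → ℝ) (g : Euc n → Euc n) : Prop :=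
  LocallyIntegrableOn u Ω ∧ LocallyIntegrableOn g Ω ∧
    ∀ φ : Euc n → ℝ, IsTestFunction Ω φ →
      ∫ x in Ω, u x • gradient φ x = - ∫ x in Ω, φ x • g x

/-- `u ∈ W₀^{1,p}(Ω)`: `u` belongs to `W^{1,p}(Ω)` (it is in `L^p(Ω)` and so is its weak gradient)
and lies in the closure of `C_c^∞(Ω)` for the norm of `W^{1,p}(Ω)`. -/
def MemSobolevZero {n : ℕ} (p : ℝ) (Ω : Set (Euc n)) (u : Euc n → ℝ) : Prop :=
  MemLp u (ENNReal.ofReal p) (volume.restrict Ω) ∧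
    ∃ g : Euc n → Euc n, HasWeakGradient Ω u g ∧
      MemLp g (ENNReal.ofReal p) (volume.restrict Ω) ∧
      ∀ ε : ENNReal, 0 < ε → ∃ φ : Euc n → ℝ, IsTestFunction Ω φ ∧
        eLpNorm (fun x => u x - φ x) (ENNReal.ofReal p) (volume.restrict Ω) < ε ∧
        eLpNorm (fun x => g x - gradient φ x) (ENNReal.ofReal p) (volume.restrict Ω) < ε

/-- The distance `δ(x)` to the boundary of `Ω`. -/
def boundaryDist {n : ℕ} (Ω : Set (Euc n)) (x : Euc n) : ℝ :=
  Metric.infDist x (frontier Ω)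

/-- The in-radius `R_in = sup_{x ∈ Ω} δ(x)`. -/
def inradius {n : ℕ} (Ω : Set (Euc n)) : ℝ :=
  sSup (boundaryDist Ω '' Ω)

/-- The Hardy constant `C_p = ((p - 1) / p) ^ p`. -/
def hardyConst (p : ℝ) : ℝ := ((p - 1) / p) ^ p

end

/-! Lower bound: write `d` for the distance to the boundary. Convexity makes `d` concave, hence
weakly superharmonic, and `|∇d| = 1` almost everywhere in `Ω`. With `A = ((p-1)/p)^(p-1)` and `f(t)
= A (t^(1-p) - t/R^p)`, where `R` is the in-radius, the function `W = f(d) |φ|^p` is nonnegative for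
every test function `φ`, so `∫ ∇d · ∇W ≥ 0`. Young's inequality, in the scalar form `young_hardy`,
bounds `∇d · ∇W` pointwise by `|∇φ|^p` minus the two terms of the Hardy inequality; integration
gives `hardy_of_isTestFunction`. Since `d` is merely Lipschitz, superharmonicity is obtained from
second differences (`integral_lineDeriv_mul_nonneg`). Density of test functions and Fatou's lemma in
a weighted `L^p` space extend the inequality to `W₀^{1,p}` (`hardy_of_memSobolevZero`).

Sharpness: a Hardy inequality with constant `K > 0` is pushed to simpler and simpler domains. The
inequality is scale invariant, and at a lowest boundary point `Ω` looks like a half-space and lies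
inside it, so `K` is admissible for the half-space (`exists_blowup_point`,
`hardy_halfSpace_of_hardy`). Products of a profile in the normal variable with increasingly flat
tangential cutoffs reduce this to the half-line (`hardy_halfLine_of_halfSpace`). There the virtual
extremal `t^((p-1)/p)`, cut off slowly in `log t`, forces `K^(1/p) ≤ (p-1)/p`
(`le_hardyConst_of_halfLine`). -/

open Set Filter Topology Metric

/-! ### Distance to the boundary of a convex set -/

section Geometry

variable {n : ℕ} {Ω : Set (Euc n)}

lemma ne_univ_of_isBounded (hn : 1 ≤ n) (hbdd : Bornology.IsBounded Ω) : Ω ≠ univ := by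
  rintro rfl
  have : Nonempty (Fin n) := ⟨⟨0, hn⟩⟩
  have : Nontrivial (Euc n) := inferInstance
  exact NormedSpace.unbounded_univ ℝ (Euc n) hbdd

/-- A point of the complement nearest to `x` lies on the frontier, and the frontier of an open set
is contained in the complement, so the two distances agree. Distance to the complement is what
controls balls inside `Ω`. -/
lemma exists_frontier_dist_eq (hopen : IsOpen Ω) (hu : Ω ≠ univ) {x : Euc n} (hx : x ∈ Ω) :
    ∃ y ∈ frontier Ω, boundaryDist Ω x = dist x y ∧ boundaryDist Ω x = infDist x Ωᶜ := by
  obtain ⟨y, hy, h⟩ := exists_mem_frontier_infDist_compl_eq_dist hx hu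
  have h1 : boundaryDist Ω x ≤ dist x y := infDist_le_dist_of_mem hy
  have h2 : infDist x Ωᶜ ≤ boundaryDist Ω x :=
    infDist_le_infDist_of_subset (fun z hz => by
      rw [hopen.frontier_eq] at hz; exact hz.2) ⟨y, hy⟩
  exact ⟨y, hy, by linarith, by linarith⟩

lemma ball_boundaryDist_subset (hopen : IsOpen Ω) (hu : Ω ≠ univ) {x : Euc n} (hx : x ∈ Ω) :
    ball x (boundaryDist Ω x) ⊆ Ω := by
  obtain ⟨y, hy, -, h⟩ := exists_frontier_dist_eq hopen hu hx
  rw [h]; exact ball_infDist_compl_subset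

lemma boundaryDist_pos (hopen : IsOpen Ω) (hu : Ω ≠ univ) {x : Euc n} (hx : x ∈ Ω) :
    0 < boundaryDist Ω x := by
  obtain ⟨y, hy, h, -⟩ := exists_frontier_dist_eq hopen hu hx
  rw [h, dist_pos]
  rintro rfl
  rw [hopen.frontier_eq] at hy; exact hy.2 hx

lemma le_boundaryDist_of_ball_subset (hopen : IsOpen Ω) (hu : Ω ≠ univ) {x : Euc n} (hx : x ∈ Ω)
    {r : ℝ} (h : ball x r ⊆ Ω) : r ≤ boundaryDist Ω x := by
  obtain ⟨y, hy, h1, -⟩ := exists_frontier_dist_eq hopen hu hx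
  rw [h1]
  by_contra! hlt
  rw [hopen.frontier_eq] at hy
  exact hy.2 (h (by rwa [mem_ball, dist_comm]))

lemma lipschitzWith_boundaryDist (Ω : Set (Euc n)) : LipschitzWith 1 (boundaryDist Ω) :=
  lipschitz_infDist_pt _

lemma boundaryDist_nonneg (Ω : Set (Euc n)) (x : Euc n) : 0 ≤ boundaryDist Ω x := infDist_nonneg

/-- Midpoint concavity of the distance to the boundary of a convex set. -/
lemma boundaryDist_add_le (hopen : IsOpen Ω) (hu : Ω ≠ univ) (hconv : Convex ℝ Ω) {x v : Euc n}
    (h1 : x + v ∈ Ω) (h2 : x - v ∈ Ω) :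
    boundaryDist Ω (x + v) + boundaryDist Ω (x - v) ≤ 2 * boundaryDist Ω x := by
  set a := boundaryDist Ω (x + v) with ha
  set b := boundaryDist Ω (x - v) with hb
  have ha0 : 0 < a := boundaryDist_pos hopen hu h1
  have hb0 : 0 < b := boundaryDist_pos hopen hu h2
  have hA := ball_boundaryDist_subset hopen hu h1
  have hB := ball_boundaryDist_subset hopen hu h2
  -- A displacement `w` shorter than `(a + b) / 2` is shared in the ratio `a : b`: moving `x + v` by
  -- `2a/(a+b) • w` and `x - v` by `2b/(a+b) • w` stays in the two inscribed balls, and the midpoint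
  -- of the results is `x + w`.
  have hball : ball x ((a + b) / 2) ⊆ Ω := by
    intro z hz
    rw [mem_ball, dist_eq_norm] at hz
    set w := z - x with hw
    have hA' : x + v + (2 * a / (a + b)) • w ∈ Ω := by
      apply hA
      rw [mem_ball, dist_eq_norm, add_sub_cancel_left, norm_smul, Real.norm_of_nonneg (by positivity)]
      rw [div_mul_eq_mul_div, div_lt_iff₀ (by positivity)]
      nlinarith
    have hB' : x - v + (2 * b / (a + b)) • w ∈ Ω := by
      apply hB
      rw [mem_ball, dist_eq_norm, add_sub_cancel_left, norm_smul, Real.norm_of_nonneg (by positivity)]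
      rw [div_mul_eq_mul_div, div_lt_iff₀ (by positivity)]
      nlinarith
    have := hconv hA' hB' (a := 1 / 2) (b := 1 / 2) (by norm_num) (by norm_num) (by norm_num)
    convert this using 1
    have h3 : w = (a / (a + b)) • w + (b / (a + b)) • w := by
      rw [← add_smul, ← add_div, div_self (by positivity), one_smul]
    have h4 : z = x + w := by rw [hw]; abel
    rw [h4]
    nth_rw 1 [h3]
    module
  have hx : x ∈ Ω := hball (mem_ball_self (by positivity))
  have := le_boundaryDist_of_ball_subset hopen hu hx hball
  linarith

/-- The Lipschitz bound gives one inequality; for the other, the distance drops at unit rate along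
the segment to a nearest boundary point. -/
lemma norm_fderiv_boundaryDist (hopen : IsOpen Ω) (hu : Ω ≠ univ) {x : Euc n} (hx : x ∈ Ω)
    (hd : DifferentiableAt ℝ (boundaryDist Ω) x) : ‖fderiv ℝ (boundaryDist Ω) x‖ = 1 := by
  apply le_antisymm
  · simpa using norm_fderiv_le_of_lipschitz ℝ (x₀ := x) (lipschitzWith_boundaryDist Ω)
  obtain ⟨y, hy, h1, -⟩ := exists_frontier_dist_eq hopen hu hx
  have hpos := boundaryDist_pos hopen hu hx
  set D := boundaryDist Ω x with hD
  have hnorm : ‖y - x‖ = D := by rw [h1, dist_eq_norm, norm_sub_rev]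
  have hlin : HasDerivAt (fun t : ℝ => boundaryDist Ω (x + t • (y - x))) (fderiv ℝ (boundaryDist Ω) x (y - x)) 0 := by
    exact (hd.hasFDerivAt.hasLineDerivAt (y - x))
  have hle : fderiv ℝ (boundaryDist Ω) x (y - x) ≤ -D := by
    have h2 : HasDerivAt (fun t : ℝ => (1 - t) * D) (-D) 0 := by
      have := ((hasDerivAt_id (0:ℝ)).const_sub 1).mul_const D
      simpa using this
    have h3 := (h2.sub hlin)
    have h4 := h3.tendsto_slope_zero_right
    have h5 : 0 ≤ -D - fderiv ℝ (boundaryDist Ω) x (y - x) := by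
      refine ge_of_tendsto h4 ?_
      filter_upwards [Ioo_mem_nhdsGT (zero_lt_one)] with t ht
      simp only [zero_add, Pi.sub_apply, smul_eq_mul, zero_smul, add_zero, sub_zero, one_mul]
      have h6 : boundaryDist Ω (x + t • (y - x)) ≤ (1 - t) * D := by
        refine (infDist_le_dist_of_mem hy).trans ?_
        rw [dist_eq_norm]
        have : x + t • (y - x) - y = (1 - t) • (x - y) := by module
        rw [this, norm_smul, Real.norm_of_nonneg (by linarith [ht.2]), norm_sub_rev, hnorm]
      have h7 : 0 ≤ t⁻¹ := by have := ht.1; positivity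
      apply mul_nonneg h7
      rw [← hD]; linarith
    linarith
  have := (fderiv ℝ (boundaryDist Ω) x).le_opNorm (y - x)
  rw [hnorm, Real.norm_eq_abs] at this
  have h8 := neg_abs_le (fderiv ℝ (boundaryDist Ω) x (y - x))
  nlinarith

lemma bddAbove_boundaryDist (hn : 1 ≤ n) (hopen : IsOpen Ω) (hbdd : Bornology.IsBounded Ω) :
    BddAbove (boundaryDist Ω '' Ω) := by
  obtain ⟨M, hM⟩ := isBounded_iff.1 hbdd.closure
  refine ⟨M, ?_⟩
  rintro _ ⟨x, hx, rfl⟩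
  obtain ⟨y, hy, h, -⟩ := exists_frontier_dist_eq hopen (ne_univ_of_isBounded hn hbdd) hx
  rw [h]
  exact hM (subset_closure hx) (frontier_subset_closure hy)

lemma boundaryDist_le_inradius (hn : 1 ≤ n) (hopen : IsOpen Ω) (hbdd : Bornology.IsBounded Ω)
    {x : Euc n} (hx : x ∈ Ω) : boundaryDist Ω x ≤ inradius Ω :=
  le_csSup (bddAbove_boundaryDist hn hopen hbdd) ⟨x, hx, rfl⟩

end Geometry

/-! ### Concavity implies weak superharmonicity -/

section Superharmonic

variable {E : Type*} [NormedAddCommGroup E] [NormedSpace ℝ E] [FiniteDimensional ℝ E]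
  [MeasurableSpace E] [BorelSpace E] {μ : Measure E} [μ.IsAddHaarMeasure]

omit [FiniteDimensional ℝ E] [MeasurableSpace E] [BorelSpace E] in
lemma lineDeriv_eq_zero_of_notMem_tsupport {W : E → ℝ} {x : E} (hx : x ∉ tsupport W) (e : E) :
    lineDeriv ℝ W x e = 0 := by
  have h : W =ᶠ[𝓝 x] fun _ => 0 := notMem_tsupport_iff_eventuallyEq.1 hx
  rw [h.lineDeriv_eq]
  simp [lineDeriv]

omit [FiniteDimensional ℝ E] in
lemma integrable_lineDeriv_mul {C C' : NNReal} {d W : E → ℝ} (hd : LipschitzWith C d)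
    (hW : LipschitzWith C' W) (hWc : HasCompactSupport W) (e : E) :
    Integrable (fun x => lineDeriv ℝ d x e * lineDeriv ℝ W x e) μ := by
  have hb : Integrable ((tsupport W).indicator fun _ : E => C * ‖e‖ * (C' * ‖e‖)) μ :=
    (integrable_indicator_iff (isClosed_tsupport W).measurableSet).2
      (integrableOn_const hWc.measure_lt_top.ne)
  refine hb.mono' ((measurable_lineDeriv hd.continuous).mul
    (measurable_lineDeriv hW.continuous)).aestronglyMeasurable (ae_of_all _ fun x => ?_)
  by_cases hx : x ∈ tsupport W
  · rw [indicator_of_mem hx, norm_mul]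
    exact mul_le_mul (norm_lineDeriv_le_of_lipschitz ℝ hd) (norm_lineDeriv_le_of_lipschitz ℝ hW)
      (norm_nonneg _) (by positivity)
  · rw [indicator_of_notMem hx, lineDeriv_eq_zero_of_notMem_tsupport hx]; simp

omit [NormedSpace ℝ E] [FiniteDimensional ℝ E] in
-- Discrete integration by parts, from translation invariance of the measure: the right side carries
-- minus the second difference of `d`, which has a sign when `d` is concave.
lemma integral_diff_mul_diff {d W : E → ℝ} (hd : Continuous d) (hW : Continuous W)
    (hWc : HasCompactSupport W) (v : E) :
    ∫ x, (d (x + v) - d x) * (W (x + v) - W x) ∂μ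
      = ∫ x, (2 * d x - d (x + v) - d (x - v)) * W x ∂μ := by
  have hWv : HasCompactSupport (fun x => W (x + v)) :=
    hWc.comp_homeomorph (Homeomorph.addRight v)
  have i1 : Integrable (fun x => (d (x + v) - d x) * W (x + v)) μ :=
    Continuous.integrable_of_hasCompactSupport (by fun_prop) hWv.mul_left
  have i2 : Integrable (fun x => (d (x + v) - d x) * W x) μ :=
    Continuous.integrable_of_hasCompactSupport (by fun_prop) hWc.mul_left
  have i3 : Integrable (fun x => (d x - d (x - v)) * W x) μ :=
    Continuous.integrable_of_hasCompactSupport (by fun_prop) hWc.mul_left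
  have e1 : ∫ x, (d (x + v) - d x) * W (x + v) ∂μ = ∫ x, (d x - d (x - v)) * W x ∂μ := by
    rw [← integral_add_right_eq_self (fun x => (d x - d (x - v)) * W x) v]
    simp
  calc ∫ x, (d (x + v) - d x) * (W (x + v) - W x) ∂μ
      = ∫ x, ((d (x + v) - d x) * W (x + v) - (d (x + v) - d x) * W x) ∂μ := by
        congr 1; ext x; ring
    _ = ∫ x, ((d x - d (x - v)) * W x - (d (x + v) - d x) * W x) ∂μ := by
        rw [integral_sub i1 i2, e1, ← integral_sub i3 i2]
    _ = _ := by congr 1; ext x; ring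

/-- A function that is midpoint concave near the support of `W ≥ 0` is weakly superharmonic
against `W`, direction by direction. -/
lemma integral_lineDeriv_mul_nonneg {C C' : NNReal} {d W : E → ℝ} (hd : LipschitzWith C d)
    (hW : LipschitzWith C' W) (hWc : HasCompactSupport W) (hW0 : ∀ x, 0 ≤ W x) {r : ℝ} (hr : 0 < r)
    (hmid : ∀ x ∈ tsupport W, ∀ v : E, ‖v‖ < r → d (x + v) + d (x - v) ≤ 2 * d x) (e : E) :
    0 ≤ ∫ x, lineDeriv ℝ d x e * lineDeriv ℝ W x e ∂μ := by
  have hK : IsCompact (cthickening ‖e‖ (tsupport W)) := hWc.isCompact.cthickening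
  have hb : Integrable ((cthickening ‖e‖ (tsupport W)).indicator
      fun _ : E => C * ‖e‖ * (C' * ‖e‖)) μ :=
    (integrable_indicator_iff hK.measurableSet).2 (integrableOn_const hK.measure_lt_top.ne)
  have hbound : ∀ {f : E → ℝ} {A : NNReal}, LipschitzWith A f → ∀ x : E, ∀ t : ℝ, 0 < t →
      |t⁻¹ * (f (x + t • e) - f x)| ≤ A * ‖e‖ := by
    intro f A hf x t ht
    have := hf.dist_le_mul (x + t • e) x
    rw [dist_eq_norm, dist_eq_norm, add_sub_cancel_left, norm_smul, Real.norm_of_nonneg ht.le] at this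
    rw [abs_mul, abs_of_pos (inv_pos.2 ht), inv_mul_le_iff₀ ht]
    rw [Real.norm_eq_abs] at this
    linarith
  -- Rademacher's theorem gives the limit of the difference quotients almost everywhere. The
  -- Lipschitz constants dominate them, and for `t < 1` the integrand lives in the `‖e‖`-thickening
  -- of the support.
  have hlim : Tendsto (fun t : ℝ => ∫ x, (t⁻¹ * (d (x + t • e) - d x)) *
      (t⁻¹ * (W (x + t • e) - W x)) ∂μ) (𝓝[>] 0)
      (𝓝 (∫ x, lineDeriv ℝ d x e * lineDeriv ℝ W x e ∂μ)) := by
    refine tendsto_integral_filter_of_dominated_convergence _ ?_ ?_ hb ?_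
    · refine Eventually.of_forall fun t => ?_
      have := hd.continuous
      have := hW.continuous
      exact Continuous.aestronglyMeasurable (by fun_prop)
    · filter_upwards [Ioo_mem_nhdsGT zero_lt_one] with t ht
      refine ae_of_all _ fun x => ?_
      by_cases hx : x ∈ cthickening ‖e‖ (tsupport W)
      · rw [indicator_of_mem hx, norm_mul]
        exact mul_le_mul (hbound hd x t ht.1) (hbound hW x t ht.1) (norm_nonneg _) (by positivity)
      · rw [indicator_of_notMem hx]
        have h1 : W x = 0 := by
          apply image_eq_zero_of_notMem_tsupport
          exact fun h => hx (self_subset_cthickening _ h)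
        have h2 : W (x + t • e) = 0 := by
          apply image_eq_zero_of_notMem_tsupport
          intro h
          apply hx
          refine mem_cthickening_of_dist_le x _ _ _ h ?_
          rw [dist_eq_norm, sub_add_cancel_left, norm_neg, norm_smul, Real.norm_of_nonneg ht.1.le]
          nlinarith [norm_nonneg e, ht.2]
        simp [h1, h2]
    · filter_upwards [hd.ae_differentiableAt (μ := μ), hW.ae_differentiableAt (μ := μ)] with x h1 h2
      have a1 := h1.lineDifferentiableAt (v := e) |>.hasLineDerivAt.tendsto_slope_zero_right
      have a2 := h2.lineDifferentiableAt (v := e) |>.hasLineDerivAt.tendsto_slope_zero_right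
      simpa using a1.mul a2
  refine ge_of_tendsto hlim ?_
  -- The `+ 1` keeps the bound on `t` meaningful when `e = 0`.
  have hpos : 0 < r / (‖e‖ + 1) := by positivity
  filter_upwards [Ioo_mem_nhdsGT hpos] with t ht
  have : ∀ x, t⁻¹ * (d (x + t • e) - d x) * (t⁻¹ * (W (x + t • e) - W x))
      = t⁻¹ ^ 2 * ((d (x + t • e) - d x) * (W (x + t • e) - W x)) := fun x => by ring
  simp_rw [this]
  rw [integral_const_mul, integral_diff_mul_diff hd.continuous hW.continuous hWc]
  refine mul_nonneg (by positivity) (integral_nonneg fun x => ?_)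
  by_cases hx : x ∈ tsupport W
  · refine mul_nonneg ?_ (hW0 x)
    have := hmid x hx (t • e) (by
      rw [norm_smul, Real.norm_of_nonneg ht.1.le]
      have := (lt_div_iff₀ (by positivity)).1 ht.2
      nlinarith [norm_nonneg e, ht.1])
    linarith
  · simp [image_eq_zero_of_notMem_tsupport hx]

end Superharmonic

/-! ### Lipschitz products -/

section LipschitzMul

lemma LipschitzWith.exists_mul_of_hasCompactSupport {X : Type*} [PseudoMetricSpace X] {C C' : NNReal}
    {F w : X → ℝ} (hF : LipschitzWith C F) (hw : LipschitzWith C' w) (hwc : HasCompactSupport w) :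
    ∃ A, LipschitzWith A (fun x => F x * w x) := by
  obtain ⟨M, hM⟩ := hwc.isCompact.exists_bound_of_continuousOn hF.continuous.continuousOn
  obtain ⟨M', hM'⟩ := hwc.exists_bound_of_continuous hw.continuous
  -- `F` may be unbounded; its bound is available only where `w` does not vanish, so the estimate is
  -- proved with such a point in first position and then symmetrized.
  have hM1 : ∀ x, w x ≠ 0 → |F x| ≤ |M| := fun x hx =>
    (hM x (subset_tsupport _ hx)).trans (le_abs_self M)
  have hM1' : ∀ x, |w x| ≤ |M'| := fun x => (hM' x).trans (le_abs_self M')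
  refine ⟨⟨|M| * C' + C * |M'|, by positivity⟩, LipschitzWith.of_dist_le_mul fun x y => ?_⟩
  have key : ∀ x y, w x ≠ 0 → |F x * w x - F y * w y| ≤ (|M| * C' + C * |M'|) * dist x y := by
    intro x y hx
    have e : F x * w x - F y * w y = F x * (w x - w y) + (F x - F y) * w y := by ring
    have h1 := hF.dist_le_mul x y
    have h2 := hw.dist_le_mul x y
    rw [Real.dist_eq] at h1 h2
    rw [e]
    refine (abs_add_le _ _).trans ?_
    rw [abs_mul, abs_mul]
    have h3 := mul_le_mul (hM1 x hx) h2 (abs_nonneg _) (abs_nonneg M)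
    have h4 := mul_le_mul h1 (hM1' y) (abs_nonneg _) (by positivity)
    linarith
  rw [Real.dist_eq]
  by_cases hx : w x = 0
  · by_cases hy : w y = 0
    · simp only [hx, hy, mul_zero, sub_self, abs_zero]; exact mul_nonneg (NNReal.coe_nonneg _) dist_nonneg
    · rw [abs_sub_comm, dist_comm]; exact key y x hy
  · exact key x y hx

end LipschitzMul

/-! ### The scalar Young inequality -/

section Scalar

lemma hardyConst_pos {p : ℝ} (hp : 1 < p) : 0 < hardyConst p :=
  Real.rpow_pos_of_pos (div_pos (by linarith) (by linarith)) _

lemma hardyConst_eq {p : ℝ} (hp : 1 < p) :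
    hardyConst p = ((p - 1) / p) ^ (p - 1) * ((p - 1) / p) := by
  have h : 0 < (p - 1) / p := div_pos (by linarith) (by linarith)
  rw [hardyConst, Real.rpow_sub_one h.ne', div_mul_cancel₀ _ h.ne']

/-- The one-dimensional supersolution `f(t) = A (t ^ (1 - p) - t / R ^ p)`, combined with Young's
inequality. Here `a` plays the role of `|∇φ|` and `b` that of `|φ|`. -/
lemma young_hardy {p R t a b : ℝ} (hp : 1 < p) (ht : 0 < t) (htR : t ≤ R) (ha : 0 ≤ a)
    (hb : 0 ≤ b) :
    ((p - 1) / p) ^ (p - 1) * (t ^ (1 - p) - t / R ^ p) * (p * b ^ (p - 1) * a)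
      + ((p - 1) / p) ^ (p - 1) * ((1 - p) * t ^ (-p) - 1 / R ^ p) * b ^ p
      ≤ a ^ p - (hardyConst p * (b ^ p / t ^ p) + (p - 1) * hardyConst p / R ^ p * b ^ p) := by
  have hp0 : 0 < p := by linarith
  have hp1 : 0 < p - 1 := by linarith
  have hR : 0 < R := ht.trans_le htR
  have hc : 0 < (p - 1) / p := div_pos hp1 hp0
  have hC := hardyConst_eq hp
  have hCpos := hardyConst_pos hp
  set A := ((p - 1) / p) ^ (p - 1) with hA
  have hApos : 0 < A := Real.rpow_pos_of_pos hc _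
  have hRp : 0 < R ^ p := Real.rpow_pos_of_pos hR _
  have htp : 0 < t ^ p := Real.rpow_pos_of_pos ht _
  set s := t ^ p / R ^ p with hs
  have hs0 : 0 ≤ s := by positivity
  have hs1 : s ≤ 1 := (div_le_one hRp).2 (Real.rpow_le_rpow ht.le htR hp0.le)
  have e1 : t ^ (1 - p) = t / t ^ p := by rw [Real.rpow_sub ht, Real.rpow_one]
  have e2 : t ^ (-p) = 1 / t ^ p := by rw [Real.rpow_neg ht.le, one_div]
  have hpq : p.HolderConjugate (p / (p - 1)) := Real.HolderConjugate.conjExponent hp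
  set q := p / (p - 1) with hq
  have hq1 : 1 ≤ q := by rw [hq, le_div_iff₀ hp1]; linarith
  have hf : A * (t ^ (1 - p) - t / R ^ p) = A * t ^ (1 - p) * (1 - s) := by
    rw [hs, e1]; field_simp
  have ht1 : 0 ≤ t ^ (1 - p) := (Real.rpow_pos_of_pos ht _).le
  have hf0 : 0 ≤ A * t ^ (1 - p) * (1 - s) :=
    mul_nonneg (mul_nonneg hApos.le ht1) (by linarith)
  -- Since `0 ≤ 1 - s ≤ 1` and `q ≥ 1`, replacing `(1 - s)^q` by `1 - s` is allowed; this
  -- linearization produces the remainder in `1 / R^p`.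
  have hpow : (A * t ^ (1 - p) * (1 - s)) ^ q ≤ hardyConst p * (1 / t ^ p - 1 / R ^ p) := by
    rw [Real.mul_rpow (mul_nonneg hApos.le ht1) (by linarith), Real.mul_rpow hApos.le ht1, hA,
      ← Real.rpow_mul hc.le, ← Real.rpow_mul ht.le]
    have h1 : (p - 1) * q = p := by rw [hq]; field_simp
    have h2 : (1 - p) * q = -p := by linarith
    have h3 : (1 - s) ^ q ≤ 1 - s := by
      have := Real.rpow_le_rpow_of_exponent_ge' (x := 1 - s) (by linarith) (by linarith) zero_le_one hq1
      rwa [Real.rpow_one] at this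
    rw [h1, h2, e2]
    have h4 : 1 / t ^ p - 1 / R ^ p = 1 / t ^ p * (1 - s) := by rw [hs]; field_simp
    rw [h4, ← mul_assoc]
    exact mul_le_mul_of_nonneg_left h3 (by positivity)
  have hyoung := Real.young_inequality_of_nonneg (a := a)
    (b := A * t ^ (1 - p) * (1 - s) * b ^ (p - 1)) ha (by positivity) hpq
  have hbq : (b ^ (p - 1)) ^ q = b ^ p := by
    rw [← Real.rpow_mul hb]; congr 1; rw [hq]; field_simp
  rw [Real.mul_rpow hf0 (by positivity), hbq] at hyoung
  have hbp : 0 ≤ b ^ p := by positivity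
  have h5 := mul_le_mul_of_nonneg_right hpow hbp
  rw [hf, e2]
  have h6 : p * (a * (A * t ^ (1 - p) * (1 - s) * b ^ (p - 1)))
      ≤ a ^ p + (p - 1) * ((A * t ^ (1 - p) * (1 - s)) ^ q * b ^ p) := by
    have := mul_le_mul_of_nonneg_left hyoung hp0.le
    refine this.trans_eq ?_
    rw [hq]; field_simp
  have hpC : A * (p - 1) = p * hardyConst p := by rw [hC]; field_simp
  have h7 : (p - 1) * ((A * t ^ (1 - p) * (1 - s)) ^ q * b ^ p) ≤
      (p - 1) * (hardyConst p * (1 / t ^ p - 1 / R ^ p) * b ^ p) :=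
    mul_le_mul_of_nonneg_left h5 hp1.le
  -- Slack coming from the linear part of `f'`; it is discarded.
  have h8 : 0 ≤ A * (1 / R ^ p) * b ^ p := by positivity
  have h9 : A * ((1 - p) * (1 / t ^ p) - 1 / R ^ p) * b ^ p
      = -(p * hardyConst p) * (1 / t ^ p) * b ^ p - A * (1 / R ^ p) * b ^ p := by
    rw [← hpC]; ring
  have h10 : hardyConst p * (b ^ p / t ^ p) + (p - 1) * hardyConst p / R ^ p * b ^ p
      = hardyConst p * (1 / t ^ p) * b ^ p + (p - 1) * hardyConst p * (1 / R ^ p) * b ^ p := by ring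
  rw [h9, h10]
  nlinarith

/-- For `r ≤ 1` the derivative of `t^r` is bounded on `[a, ∞)`. The truncation makes the singular
factor `d^(1-p)` globally Lipschitz. -/
lemma exists_lipschitzWith_max_rpow {a r : ℝ} (ha : 0 < a) (hr : r ≤ 1) :
    ∃ C, LipschitzWith C (fun t : ℝ => (max t a) ^ r) := by
  have hbound : ∀ x ∈ Ici a, ‖deriv (fun t : ℝ => t ^ r) x‖₊ ≤ Real.toNNReal (|r| * a ^ (r - 1)) := by
    intro x hx
    have hx0 : 0 < x := ha.trans_le hx
    rw [← NNReal.coe_le_coe, coe_nnnorm, Real.coe_toNNReal _ (by positivity)]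
    rw [Real.deriv_rpow_const, norm_mul, Real.norm_eq_abs, Real.norm_of_nonneg (by positivity)]
    exact mul_le_mul_of_nonneg_left (Real.rpow_le_rpow_of_nonpos ha hx (by linarith)) (abs_nonneg _)
  have hL := (convex_Ici a).lipschitzOnWith_of_nnnorm_deriv_le (𝕜 := ℝ) (f := fun t : ℝ => t ^ r)
    (fun x hx => (Real.differentiableAt_rpow_const_of_ne r (ha.trans_le hx).ne')) hbound
  refine ⟨Real.toNNReal (|r| * a ^ (r - 1)), LipschitzWith.of_dist_le_mul fun x y => ?_⟩
  refine (hL.dist_le_mul (max x a) (mem_Ici.2 (le_max_right x a)) (max y a)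
    (mem_Ici.2 (le_max_right y a))).trans ?_
  refine mul_le_mul_of_nonneg_left ?_ (NNReal.coe_nonneg _)
  have := (LipschitzWith.id.max_const a).dist_le_mul x y
  simpa using this

end Scalar

/-! ### Coordinate sums as inner products of differentials -/

section Dual

variable {n : ℕ}

lemma sum_apply_mul_apply (L M : Euc n →L[ℝ] ℝ) :
    ∑ i, L (EuclideanSpace.basisFun (Fin n) ℝ i) * M (EuclideanSpace.basisFun (Fin n) ℝ i)
      = inner ℝ ((InnerProductSpace.toDual ℝ (Euc n)).symm L)
          ((InnerProductSpace.toDual ℝ (Euc n)).symm M) := by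
  rw [← (EuclideanSpace.basisFun (Fin n) ℝ).sum_inner_mul_inner]
  refine Finset.sum_congr rfl fun i _ => ?_
  rw [InnerProductSpace.toDual_symm_apply, real_inner_comm, InnerProductSpace.toDual_symm_apply]

lemma sum_apply_sq (L : Euc n →L[ℝ] ℝ) :
    ∑ i, L (EuclideanSpace.basisFun (Fin n) ℝ i) * L (EuclideanSpace.basisFun (Fin n) ℝ i)
      = ‖L‖ ^ 2 := by
  rw [sum_apply_mul_apply, real_inner_self_eq_norm_sq, LinearIsometryEquiv.norm_map]

lemma abs_sum_apply_mul_apply_le (L M : Euc n →L[ℝ] ℝ) :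
    |∑ i, L (EuclideanSpace.basisFun (Fin n) ℝ i) * M (EuclideanSpace.basisFun (Fin n) ℝ i)|
      ≤ ‖L‖ * ‖M‖ := by
  rw [sum_apply_mul_apply]
  refine (abs_real_inner_le_norm _ _).trans ?_
  rw [LinearIsometryEquiv.norm_map, LinearIsometryEquiv.norm_map]

lemma norm_gradient (φ : Euc n → ℝ) (x : Euc n) : ‖gradient φ x‖ = ‖fderiv ℝ φ x‖ := by
  rw [gradient, LinearIsometryEquiv.norm_map]

end Dual

/-! ### The Hardy inequality for test functions -/

section TestFunctions

variable {n : ℕ} {Ω : Set (Euc n)} {p : ℝ} {φ : Euc n → ℝ}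

lemma IsTestFunction.continuous_gradient (h : IsTestFunction Ω φ) : Continuous (gradient φ) :=
  (InnerProductSpace.toDual ℝ (Euc n)).symm.continuous.comp (h.1.continuous_fderiv (by simp))

lemma IsTestFunction.hasCompactSupport_gradient (h : IsTestFunction Ω φ) :
    HasCompactSupport (gradient φ) :=
  (h.2.1.fderiv (𝕜 := ℝ)).comp_left (g := (InnerProductSpace.toDual ℝ (Euc n)).symm) (by simp)

lemma IsTestFunction.integrable_norm_gradient_rpow (hp : 0 < p) (h : IsTestFunction Ω φ) :
    Integrable (fun x => ‖gradient φ x‖ ^ p) :=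
  (h.continuous_gradient.norm.rpow_const fun _ => Or.inr hp.le).integrable_of_hasCompactSupport
    (h.hasCompactSupport_gradient.comp_left (g := fun v => ‖v‖ ^ p) (by simp [Real.zero_rpow hp.ne']))

lemma IsTestFunction.hasCompactSupport_abs_rpow (hp : 0 < p) (h : IsTestFunction Ω φ) :
    HasCompactSupport (fun x => |φ x| ^ p) :=
  h.2.1.comp_left (g := fun v => |v| ^ p) (by simp [Real.zero_rpow hp.ne'])

lemma IsTestFunction.integrable_abs_rpow (hp : 0 < p) (h : IsTestFunction Ω φ) :
    Integrable (fun x => |φ x| ^ p) :=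
  (h.1.continuous.abs.rpow_const fun _ => Or.inr hp.le).integrable_of_hasCompactSupport
    (h.hasCompactSupport_abs_rpow hp)

/-- Hardy quotients of test functions are integrable against any weight that is continuous and
positive on the support. -/
lemma IsTestFunction.integrable_abs_rpow_div (hp : 0 < p) (h : IsTestFunction Ω φ) {d : Euc n → ℝ}
    (hd : Continuous d) (hpos : ∀ x ∈ Ω, 0 < d x) :
    Integrable (fun x => |φ x| ^ p / d x ^ p) := by
  obtain ⟨a, ha, hda⟩ := h.2.1.isCompact.exists_forall_le' hd.continuousOn
    (fun x hx => hpos x (h.2.2 hx))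
  have : (fun x => |φ x| ^ p / d x ^ p) = fun x => |φ x| ^ p / (max (d x) a) ^ p := by
    ext x
    by_cases hx : x ∈ tsupport φ
    · rw [max_eq_left (hda x hx)]
    · simp [image_eq_zero_of_notMem_tsupport hx, Real.zero_rpow hp.ne']
  rw [this]
  have hc : Continuous fun x => |φ x| ^ p / (max (d x) a) ^ p := by
    refine (h.1.continuous.abs.rpow_const fun _ => Or.inr hp.le).div
      ((hd.max continuous_const).rpow_const fun _ => Or.inr hp.le) fun x => ?_
    exact (Real.rpow_pos_of_pos (lt_max_of_lt_right ha) _).ne'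
  refine hc.integrable_of_hasCompactSupport ?_
  simp_rw [div_eq_mul_inv]
  exact (h.hasCompactSupport_abs_rpow hp).mul_right

lemma hardy_of_isTestFunction (hn : 1 ≤ n) (hp : 1 < p) (hopen : IsOpen Ω)
    (hbdd : Bornology.IsBounded Ω) (hconv : Convex ℝ Ω) (hφ : IsTestFunction Ω φ) :
    hardyConst p * (∫ x in Ω, |φ x| ^ p / boundaryDist Ω x ^ p)
        + ((p - 1) * hardyConst p / inradius Ω ^ p) * (∫ x in Ω, |φ x| ^ p)
      ≤ ∫ x in Ω, ‖gradient φ x‖ ^ p := by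
  have hp0 : 0 < p := by linarith
  have hu := ne_univ_of_isBounded hn hbdd
  set d := boundaryDist Ω with hd
  set R := inradius Ω with hR
  set A := ((p - 1) / p) ^ (p - 1) with hA
  have hApos : 0 < A := Real.rpow_pos_of_pos (div_pos (by linarith) hp0) _
  have hdL : LipschitzWith 1 d := lipschitzWith_boundaryDist Ω
  obtain ⟨b, hb, hdb⟩ := hφ.2.1.isCompact.exists_forall_le' hdL.continuous.continuousOn
    (fun x hx => boundaryDist_pos hopen hu (hφ.2.2 hx))
  -- Half the minimum level `b`, so that the truncation at `a` is inactive in a neighbourhood of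
  -- each support point and does not affect derivatives there.
  set a := b / 2 with hab
  have ha : 0 < a := by positivity
  set w : Euc n → ℝ := fun x => |φ x| ^ p with hw
  have hwc : HasCompactSupport w := hφ.hasCompactSupport_abs_rpow hp0
  have hwsupp : tsupport w ⊆ tsupport φ := by
    refine closure_mono fun x hx => ?_
    simp only [hw, Function.mem_support] at hx ⊢
    rintro h0; simp [h0, Real.zero_rpow hp0.ne'] at hx
  have hwC1 : ContDiff ℝ 1 w := by
    have := (hφ.1.of_le (m := 1) (by norm_cast)).norm_rpow hp
    simpa [hw] using this
  obtain ⟨C₁, hwL⟩ := hwC1.lipschitzWith_of_hasCompactSupport hwc (by simp)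
  obtain ⟨C₀, hmaxL⟩ := exists_lipschitzWith_max_rpow (r := 1 - p) ha (by linarith)
  set F : Euc n → ℝ := fun x => A * ((max (d x) a) ^ (1 - p) - d x / R ^ p) with hF
  obtain ⟨C₂, hFL⟩ : ∃ C, LipschitzWith C F := by
    have h1 := (hmaxL.comp hdL)
    have h2 : LipschitzWith (‖(R ^ p)⁻¹‖₊ * 1) (fun x => d x / R ^ p) := by
      have e : (fun x => d x / R ^ p) = (fun t : ℝ => (R ^ p)⁻¹ • t) ∘ d := by
        ext x; simp [div_eq_inv_mul]
      rw [e]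
      exact (lipschitzWith_smul ((R ^ p)⁻¹ : ℝ)).comp hdL
    exact ⟨_, (lipschitzWith_smul A).comp (h1.sub h2)⟩
  obtain ⟨C₃, hWL⟩ := hFL.exists_mul_of_hasCompactSupport hwL hwc
  set W : Euc n → ℝ := fun x => F x * w x with hW
  have hWc : HasCompactSupport W := hwc.mul_left
  have hWsupp : tsupport W ⊆ tsupport φ :=
    (tsupport_mul_subset_right).trans hwsupp
  have hW0 : ∀ x, 0 ≤ W x := by
    intro x
    by_cases hx : x ∈ tsupport φ
    · refine mul_nonneg (mul_nonneg hApos.le ?_) (by positivity)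
      have hx1 := hdb x hx
      have hx2 : d x ≤ R := boundaryDist_le_inradius hn hopen hbdd (hφ.2.2 hx)
      have hx0 : 0 < d x := by linarith
      rw [max_eq_left (by linarith), Real.rpow_sub hx0, Real.rpow_one, sub_nonneg]
      exact div_le_div_of_nonneg_left hx0.le (Real.rpow_pos_of_pos hx0 _)
        (Real.rpow_le_rpow hx0.le hx2 hp0.le)
    · have : φ x = 0 := image_eq_zero_of_notMem_tsupport hx
      simp [hW, hw, this, Real.zero_rpow hp0.ne']
  have hmid : ∀ x ∈ tsupport W, ∀ v : Euc n, ‖v‖ < b → d (x + v) + d (x - v) ≤ 2 * d x := by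
    intro x hx v hv
    have hxK := hWsupp hx
    have hball := ball_boundaryDist_subset hopen hu (hφ.2.2 hxK)
    have := hdb x hxK
    refine boundaryDist_add_le hopen hu hconv (hball ?_) (hball ?_)
    · rw [mem_ball, dist_eq_norm, add_sub_cancel_left]; linarith
    · rw [mem_ball, dist_eq_norm, sub_sub_cancel_left, norm_neg]; linarith
  -- This is `∇d · ∇W` in coordinates, so superharmonicity can be summed over directions.
  set G : Euc n → ℝ := fun x => ∑ i, lineDeriv ℝ d x (EuclideanSpace.basisFun (Fin n) ℝ i) *
    lineDeriv ℝ W x (EuclideanSpace.basisFun (Fin n) ℝ i) with hG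
  have hGint : Integrable G := integrable_finsetSum _ fun i _ => integrable_lineDeriv_mul hdL hWL hWc _
  have hG0 : 0 ≤ ∫ x, G x := by
    rw [hG, integral_finsetSum _ fun i _ => integrable_lineDeriv_mul hdL hWL hWc _]
    exact Finset.sum_nonneg fun i _ => integral_lineDeriv_mul_nonneg hdL hWL hWc hW0 hb hmid _
  set H : Euc n → ℝ := fun x => ‖gradient φ x‖ ^ p -
    (hardyConst p * (|φ x| ^ p / d x ^ p) + (p - 1) * hardyConst p / R ^ p * |φ x| ^ p) with hH
  have i1 := hφ.integrable_norm_gradient_rpow hp0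
  have i2 := hφ.integrable_abs_rpow_div hp0 hdL.continuous fun x hx => boundaryDist_pos hopen hu hx
  have i3 := hφ.integrable_abs_rpow hp0
  have hGH : ∀ᵐ x, G x ≤ H x := by
    filter_upwards [hdL.ae_differentiableAt (μ := volume), hWL.ae_differentiableAt (μ := volume)]
      with x hdx hWx
    by_cases hx : x ∈ tsupport φ
    · have hdbx := hdb x hx
      have hx0 : 0 < d x := by linarith
      have hxR : d x ≤ R := boundaryDist_le_inradius hn hopen hbdd (hφ.2.2 hx)
      have hnorm : ‖fderiv ℝ d x‖ = 1 := norm_fderiv_boundaryDist hopen hu (hφ.2.2 hx) hdx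
      have hφx : HasFDerivAt φ (fderiv ℝ φ x) x := (hφ.1.differentiable (by simp) x).hasFDerivAt
      have hwx : HasFDerivAt w ((p * |φ x| ^ (p - 2) * φ x) • fderiv ℝ φ x) x :=
        (hasDerivAt_abs_rpow (φ x) hp).comp_hasFDerivAt x hφx
      have hFx : HasFDerivAt F ((A * ((1 - p) * d x ^ (-p) - 1 / R ^ p)) • fderiv ℝ d x) x := by
        have hder : HasDerivAt (fun t : ℝ => A * (t ^ (1 - p) - t / R ^ p))
            (A * ((1 - p) * d x ^ (-p) - 1 / R ^ p)) (d x) := by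
          have h1 := Real.hasDerivAt_rpow_const (x := d x) (p := 1 - p) (Or.inl hx0.ne')
          have h2 := (h1.sub ((hasDerivAt_id (d x)).div_const (R ^ p))).const_mul A
          rw [show 1 - p - 1 = -p by ring] at h2
          exact h2
        refine (hder.comp_hasFDerivAt x hdx.hasFDerivAt).congr_of_eventuallyEq ?_
        have : ∀ᶠ y in 𝓝 x, a < d y := hdL.continuous.continuousAt.eventually_const_lt (by linarith)
        filter_upwards [this] with y hy
        simp [hF, max_eq_left hy.le]
      have hFval : F x = A * (d x ^ (1 - p) - d x / R ^ p) := by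
        rw [hF]; simp only; rw [max_eq_left (by linarith)]
      have hWd : HasFDerivAt W (F x • (p * |φ x| ^ (p - 2) * φ x) • fderiv ℝ φ x +
          w x • (A * ((1 - p) * d x ^ (-p) - 1 / R ^ p)) • fderiv ℝ d x) x := hFx.mul hwx
      have hy := young_hardy hp hx0 hxR (norm_nonneg (gradient φ x)) (abs_nonneg (φ x))
      have hF0 : 0 ≤ F x := by
        rw [hFval]
        refine mul_nonneg hApos.le ?_
        rw [Real.rpow_sub hx0, Real.rpow_one, sub_nonneg]
        exact div_le_div_of_nonneg_left hx0.le (Real.rpow_pos_of_pos hx0 _)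
          (Real.rpow_le_rpow hx0.le hxR hp0.le)
      refine le_trans ?_ hy
      -- Product rule: `f(d) ∇d · ∇|φ|^p + f'(d) |φ|^p |∇d|²`, where the last factor is 1.
      have hGx : G x = F x * (p * |φ x| ^ (p - 2) * φ x) *
            (∑ i, fderiv ℝ d x (EuclideanSpace.basisFun (Fin n) ℝ i) *
              fderiv ℝ φ x (EuclideanSpace.basisFun (Fin n) ℝ i))
          + A * ((1 - p) * d x ^ (-p) - 1 / R ^ p) * w x *
            (∑ i, fderiv ℝ d x (EuclideanSpace.basisFun (Fin n) ℝ i) *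
              fderiv ℝ d x (EuclideanSpace.basisFun (Fin n) ℝ i)) := by
        rw [hG, Finset.mul_sum, Finset.mul_sum, ← Finset.sum_add_distrib]
        refine Finset.sum_congr rfl fun i _ => ?_
        rw [hdx.lineDeriv_eq_fderiv, hWx.lineDeriv_eq_fderiv, hWd.fderiv]
        simp only [add_apply, smul_apply, smul_eq_mul]
        ring
      rw [hGx, sum_apply_sq, hnorm, one_pow, mul_one, ← hFval]
      refine add_le_add ?_ le_rfl
      rw [mul_assoc]
      refine mul_le_mul_of_nonneg_left ?_ hF0
      refine (le_abs_self _).trans ?_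
      rw [abs_mul]
      have h1 : |p * |φ x| ^ (p - 2) * φ x| = p * |φ x| ^ (p - 1) := by
        rw [abs_mul, abs_mul, abs_of_pos hp0, abs_of_nonneg (by positivity), mul_assoc]
        congr 1
        by_cases h0 : φ x = 0
        · simp [h0, Real.zero_rpow (by linarith : p - 1 ≠ 0)]
        · rw [← Real.rpow_add_one (abs_pos.2 h0).ne']; congr 1; ring
      rw [h1, norm_gradient]
      refine mul_le_mul_of_nonneg_left ?_ (by positivity)
      simpa [hnorm] using abs_sum_apply_mul_apply_le (fderiv ℝ d x) (fderiv ℝ φ x)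
    · have h1 : G x = 0 := by
        rw [hG]
        refine Finset.sum_eq_zero fun i _ => ?_
        rw [lineDeriv_eq_zero_of_notMem_tsupport fun h => hx (hWsupp h), mul_zero]
      have h2 : φ x = 0 := image_eq_zero_of_notMem_tsupport hx
      rw [h1, hH]
      simp only [h2, abs_zero, Real.zero_rpow hp0.ne', zero_div, mul_zero, add_zero, sub_zero]
      positivity
  have iH : Integrable H := i1.sub ((i2.const_mul _).add (i3.const_mul _))
  have hH0 : 0 ≤ ∫ x in Ω, H x := by
    have : ∫ x in Ω, H x = ∫ x, H x := by
      refine setIntegral_eq_integral_of_forall_compl_eq_zero fun x hx => ?_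
      have hx' : x ∉ tsupport φ := fun h => hx (hφ.2.2 h)
      have h2 : φ x = 0 := image_eq_zero_of_notMem_tsupport hx'
      have h3 : fderiv ℝ φ x = 0 := by
        by_contra h
        exact hx' (support_fderiv_subset ℝ h)
      simp [hH, h2, norm_gradient, h3, Real.zero_rpow hp0.ne']
    rw [this]
    exact hG0.trans (integral_mono_ae hGint iH hGH)
  have j2 := (i2.const_mul (hardyConst p)).integrableOn (s := Ω)
  have j3 := (i3.const_mul ((p - 1) * hardyConst p / R ^ p)).integrableOn (s := Ω)
  have e1 := integral_sub i1.integrableOn (j2.add j3)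
  have e2 := integral_add j2 j3
  simp only [Pi.add_apply] at e1
  rw [integral_const_mul, integral_const_mul] at e2
  simp only [hH] at hH0
  rw [e1, e2] at hH0
  linarith

end TestFunctions

/-! ### Weak gradients -/

section WeakGradient

variable {n : ℕ} {Ω : Set (Euc n)}

lemma integrableOn_smul_of_isTestFunction {F : Type*} [NormedAddCommGroup F] [NormedSpace ℝ F]
    {g : Euc n → F} (hg : LocallyIntegrableOn g Ω) {φ : Euc n → ℝ} (hφ : IsTestFunction Ω φ) :
    Integrable (fun x => φ x • g x) := by
  have hK := hg.integrableOn_compact_subset hφ.2.2 hφ.2.1.isCompact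
  have h := hK.continuousOn_smul hφ.1.continuous.continuousOn hφ.2.1.isCompact
  refine (integrableOn_iff_integrable_of_support_subset fun x hx => ?_).1 h
  refine subset_tsupport _ fun h0 => hx ?_
  simp [h0]

/-- The fundamental lemma of the calculus of variations. It identifies an arbitrary weak gradient
with the one approximated in `MemSobolevZero`. -/
lemma HasWeakGradient.ae_eq (hopen : IsOpen Ω) {u : Euc n → ℝ} {g g' : Euc n → Euc n}
    (h : HasWeakGradient Ω u g) (h' : HasWeakGradient Ω u g') :
    g =ᵐ[volume.restrict Ω] g' := by
  have key := hopen.ae_eq_zero_of_integral_contDiff_smul_eq_zero (μ := volume)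
    (h.2.1.sub h'.2.1) (fun φ h1 h2 h3 => by
      have hφ : IsTestFunction Ω φ := ⟨h1, h2, h3⟩
      have e := (h.2.2 φ hφ).symm.trans (h'.2.2 φ hφ)
      rw [neg_inj] at e
      have i1 := integrableOn_smul_of_isTestFunction h.2.1 hφ
      have i2 := integrableOn_smul_of_isTestFunction h'.2.1 hφ
      rw [← setIntegral_eq_integral_of_forall_compl_eq_zero (s := Ω) fun x hx => by
        rw [image_eq_zero_of_notMem_tsupport fun hx' => hx (h3 hx'), zero_smul]]
      simp only [Pi.sub_apply, smul_sub]
      rw [integral_sub i1.integrableOn i2.integrableOn, e, sub_self])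
  refine (ae_restrict_iff' hopen.measurableSet).2 ?_
  filter_upwards [key] with x hx hxΩ
  exact sub_eq_zero.1 (hx hxΩ)

lemma IsTestFunction.gradient_eq_zero {φ : Euc n → ℝ} (hφ : IsTestFunction Ω φ) {x : Euc n}
    (hx : x ∉ Ω) : gradient φ x = 0 := by
  have hx' : x ∉ tsupport φ := fun h => hx (hφ.2.2 h)
  have h3 : fderiv ℝ φ x = 0 := by
    by_contra h
    exact hx' (support_fderiv_subset ℝ h)
  rw [gradient, h3, map_zero]

lemma IsTestFunction.eq_zero {φ : Euc n → ℝ} (hφ : IsTestFunction Ω φ) {x : Euc n}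
    (hx : x ∉ Ω) : φ x = 0 :=
  image_eq_zero_of_notMem_tsupport fun h => hx (hφ.2.2 h)

lemma IsTestFunction.hasWeakGradient {φ : Euc n → ℝ} (hφ : IsTestFunction Ω φ) :
    HasWeakGradient Ω φ (gradient φ) := by
  refine ⟨hφ.1.continuous.locallyIntegrable.locallyIntegrableOn _,
    hφ.continuous_gradient.locallyIntegrable.locallyIntegrableOn _, fun ψ hψ => ?_⟩
  rw [setIntegral_eq_integral_of_forall_compl_eq_zero fun x hx => by rw [hφ.eq_zero hx, zero_smul],
    setIntegral_eq_integral_of_forall_compl_eq_zero fun x hx => by rw [hψ.eq_zero hx, zero_smul]]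
  have i1 : Integrable fun x => φ x • gradient ψ x :=
    integrableOn_smul_of_isTestFunction (hψ.continuous_gradient.locallyIntegrable.locallyIntegrableOn _) hφ
  have i2 : Integrable fun x => ψ x • gradient φ x :=
    integrableOn_smul_of_isTestFunction (hφ.continuous_gradient.locallyIntegrable.locallyIntegrableOn _) hψ
  refine ext_inner_right ℝ fun v => ?_
  rw [inner_neg_left, real_inner_comm, real_inner_comm v (∫ x, ψ x • gradient φ x),
    ← integral_inner i1, ← integral_inner i2]
  have hv : ∀ f : Euc n → ℝ, ∀ x, inner ℝ v (gradient f x) = fderiv ℝ f x v := fun f x => by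
    rw [real_inner_comm, gradient, InnerProductSpace.toDual_symm_apply]
  simp only [inner_smul_right, hv]
  have c1 : Continuous fun x => fderiv ℝ φ x v := (hφ.1.continuous_fderiv (by simp)).clm_apply continuous_const
  have c2 : Continuous fun x => fderiv ℝ ψ x v := (hψ.1.continuous_fderiv (by simp)).clm_apply continuous_const
  have := hφ.1.continuous
  have := hψ.1.continuous
  rw [integral_mul_fderiv_eq_neg_fderiv_mul_of_integrable]
  · simp_rw [mul_comm]
  · exact Continuous.integrable_of_hasCompactSupport (by fun_prop) hψ.2.1.mul_left
  · exact Continuous.integrable_of_hasCompactSupport (by fun_prop) hφ.2.1.mul_right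
  · exact Continuous.integrable_of_hasCompactSupport (by fun_prop) hφ.2.1.mul_right
  · exact fun x _ => hφ.1.differentiable (by simp) x
  · exact fun x _ => hψ.1.differentiable (by simp) x

lemma IsTestFunction.memSobolevZero {φ : Euc n → ℝ} (hφ : IsTestFunction Ω φ) (p : ℝ) :
    MemSobolevZero p Ω φ := by
  refine ⟨(hφ.1.continuous.memLp_of_hasCompactSupport hφ.2.1).restrict Ω, gradient φ,
    hφ.hasWeakGradient,
    (hφ.continuous_gradient.memLp_of_hasCompactSupport hφ.hasCompactSupport_gradient).restrict Ω,
    fun ε hε => ⟨φ, hφ, ?_, ?_⟩⟩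
  · simpa using hε
  · simpa using hε

end WeakGradient

/-! ### Passage to the Sobolev space -/

section Density

lemma eLpNorm_rpow_eq_lintegral {α : Type*} [MeasurableSpace α] {E : Type*} [NormedAddCommGroup E]
    {μ : Measure α} {p : ℝ} (hp : 0 < p) (f : α → E) :
    eLpNorm f (ENNReal.ofReal p) μ ^ p = ∫⁻ x, ENNReal.ofReal (‖f x‖ ^ p) ∂μ := by
  rw [eLpNorm_eq_lintegral_rpow_enorm_toReal (by simpa using hp) ENNReal.ofReal_ne_top,
    ENNReal.toReal_ofReal hp.le, ← ENNReal.rpow_mul, one_div_mul_cancel hp.ne', ENNReal.rpow_one]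
  refine lintegral_congr fun x => ?_
  rw [← ofReal_norm, ENNReal.ofReal_rpow_of_nonneg (norm_nonneg _) hp.le]

lemma eLpNorm_withDensity_rpow {α : Type*} [MeasurableSpace α]
    {μ : Measure α} {p : ℝ} (hp : 0 < p) {f : α → ℝ} {w : α → ℝ}
    (hw : Measurable w) (hf : AEStronglyMeasurable f μ) :
    eLpNorm f (ENNReal.ofReal p) (μ.withDensity fun x => ENNReal.ofReal (w x)) ^ p
      = ∫⁻ x, ENNReal.ofReal (w x * |f x| ^ p) ∂μ := by
  rw [eLpNorm_rpow_eq_lintegral hp, lintegral_withDensity_eq_lintegral_mul₀ (by fun_prop)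
    (by fun_prop)]
  refine lintegral_congr fun x => ?_
  rw [Pi.mul_apply, ENNReal.ofReal_mul' (by positivity), Real.norm_eq_abs]

variable {n : ℕ} {Ω : Set (Euc n)} {p : ℝ}

lemma hardy_of_memSobolevZero (hn : 1 ≤ n) (hp : 1 < p) (hopen : IsOpen Ω)
    (hbdd : Bornology.IsBounded Ω) (hconv : Convex ℝ Ω) {u : Euc n → ℝ} {g : Euc n → Euc n}
    (hu : MemSobolevZero p Ω u) (hg : HasWeakGradient Ω u g) :
    IntegrableOn (fun x => |u x| ^ p / boundaryDist Ω x ^ p) Ω ∧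
      hardyConst p * (∫ x in Ω, |u x| ^ p / boundaryDist Ω x ^ p)
          + ((p - 1) * hardyConst p / inradius Ω ^ p) * (∫ x in Ω, |u x| ^ p)
        ≤ ∫ x in Ω, ‖g x‖ ^ p := by
  obtain ⟨huL, g', hg', hgL', happ⟩ := hu
  have hgg : g' =ᵐ[volume.restrict Ω] g := hg'.ae_eq hopen hg
  have hp0 : 0 < p := by linarith
  have hp1 : (1 : ENNReal) ≤ ENNReal.ofReal p := by
    rw [← ENNReal.ofReal_one]; exact ENNReal.ofReal_le_ofReal hp.le
  have hne := ne_univ_of_isBounded hn hbdd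
  have hgL : MemLp g (ENNReal.ofReal p) (volume.restrict Ω) := hgL'.ae_eq hgg
  set d := boundaryDist Ω with hd
  have hdc : Continuous d := (lipschitzWith_boundaryDist Ω).continuous
  have hC := hardyConst_pos hp
  set c := (p - 1) * hardyConst p / inradius Ω ^ p with hc
  set m := volume.restrict Ω with hm
  -- Both left-hand terms are merged into one weight, so the inequality says that the `L^p(ν)` norm
  -- of `φ` is at most the `L^p` norm of its gradient.
  set w : Euc n → ℝ := fun x => hardyConst p / d x ^ p + c with hw
  have hwm : Measurable w := ((measurable_const.div (hdc.measurable.pow_const p)).add_const c)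
  set ν := m.withDensity fun x => ENNReal.ofReal (w x) with hν
  have hR0 : 0 ≤ inradius Ω :=
    Real.sSup_nonneg (by rintro _ ⟨x, -, rfl⟩; exact boundaryDist_nonneg Ω x)
  have hc0 : 0 ≤ c :=
    div_nonneg (mul_nonneg (by linarith) hC.le) (Real.rpow_nonneg hR0 p)
  have hw0 : ∀ x, 0 ≤ w x := fun x =>
    add_nonneg (div_nonneg hC.le (Real.rpow_nonneg (boundaryDist_nonneg Ω x) p)) hc0
  have htest : ∀ φ, IsTestFunction Ω φ → eLpNorm φ (ENNReal.ofReal p) ν ≤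
      eLpNorm (gradient φ) (ENNReal.ofReal p) m := by
    intro φ hφ
    rw [← ENNReal.rpow_le_rpow_iff hp0, hν, eLpNorm_withDensity_rpow hp0 hwm
      hφ.1.continuous.aestronglyMeasurable, eLpNorm_rpow_eq_lintegral hp0]
    have h := hardy_of_isTestFunction hn hp hopen hbdd hconv hφ
    have i1 := (hφ.integrable_norm_gradient_rpow hp0).integrableOn (s := Ω)
    have i2 := ((hφ.integrable_abs_rpow_div hp0 hdc fun x hx =>
      boundaryDist_pos hopen hne hx).const_mul (hardyConst p)).integrableOn (s := Ω)
    have i3 := ((hφ.integrable_abs_rpow hp0).const_mul c).integrableOn (s := Ω)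
    have e : ∀ x, w x * |φ x| ^ p = hardyConst p * (|φ x| ^ p / d x ^ p) + c * |φ x| ^ p :=
      fun x => by rw [hw]; ring
    have i4 : Integrable (fun x => w x * |φ x| ^ p) m := by
      simp_rw [e]; exact i2.add i3
    rw [← ofReal_integral_eq_lintegral_ofReal i1 (ae_of_all _ fun x => by positivity),
      ← ofReal_integral_eq_lintegral_ofReal i4
        (ae_of_all _ fun x => mul_nonneg (hw0 x) (by positivity))]
    refine ENNReal.ofReal_le_ofReal ?_
    simp_rw [e]
    rw [integral_add i2 i3, integral_const_mul, integral_const_mul]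
    exact h
  choose φ hφ hφu hφg using fun k : ℕ => happ (ENNReal.ofReal (1 / (k + 1 : ℝ)))
    (ENNReal.ofReal_pos.2 (by positivity))
  have hε : Tendsto (fun k : ℕ => ENNReal.ofReal (1 / (k + 1 : ℝ))) atTop (𝓝 0) := by
    have := ENNReal.tendsto_ofReal (tendsto_one_div_add_atTop_nhds_zero_nat (𝕜 := ℝ))
    simpa using this
  have hmeas := tendstoInMeasure_of_tendsto_eLpNorm (p := ENNReal.ofReal p) (μ := m) (f := φ)
    (g := u) (l := atTop) (by simpa using hp0)
    (fun k => (hφ k).1.continuous.aestronglyMeasurable) huL.1 (by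
      refine tendsto_of_tendsto_of_tendsto_of_le_of_le tendsto_const_nhds hε (fun _ => zero_le)
        fun k => ?_
      rw [← eLpNorm_neg, neg_sub]
      exact (hφu k).le)
  obtain ⟨s, hs, hae⟩ := hmeas.exists_seq_tendsto_ae
  have hνm : ν ≪ m := withDensity_absolutelyContinuous _ _
  -- Fatou along an almost everywhere convergent subsequence; extended norms require no prior
  -- integrability of the Hardy quotient, which is then deduced from this bound.
  have hlim : eLpNorm u (ENNReal.ofReal p) ν ≤ eLpNorm g (ENNReal.ofReal p) m := by
    refine (Lp.eLpNorm_lim_le_liminf_eLpNorm (f := fun k => φ (s k))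
      (fun k => (hφ _).1.continuous.aestronglyMeasurable) u (hνm.ae_le hae)).trans ?_
    have hb : ∀ k, eLpNorm (φ (s k)) (ENNReal.ofReal p) ν ≤
        eLpNorm g (ENNReal.ofReal p) m + ENNReal.ofReal (1 / (s k + 1 : ℝ)) := by
      intro k
      refine (htest _ (hφ _)).trans ?_
      rw [← eLpNorm_congr_ae hgg]
      have : gradient (φ (s k)) = g' - fun x => g' x - gradient (φ (s k)) x := by
        ext1 x; simp
      calc eLpNorm (gradient (φ (s k))) (ENNReal.ofReal p) m
          = eLpNorm (g' - fun x => g' x - gradient (φ (s k)) x) (ENNReal.ofReal p) m := by rw [← this]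
        _ ≤ _ := eLpNorm_sub_le hgL'.1
            (hgL'.1.sub (hφ _).continuous_gradient.aestronglyMeasurable) hp1
        _ ≤ _ := add_le_add le_rfl (hφg _).le
    have ht : Tendsto (fun k => eLpNorm g (ENNReal.ofReal p) m +
        ENNReal.ofReal (1 / (s k + 1 : ℝ))) atTop (𝓝 (eLpNorm g (ENNReal.ofReal p) m)) := by
      simpa using (hε.comp hs.tendsto_atTop).const_add (eLpNorm g (ENNReal.ofReal p) m)
    rw [← ht.liminf_eq]
    exact liminf_le_liminf (Eventually.of_forall hb)
  rw [← ENNReal.rpow_le_rpow_iff hp0, hν, eLpNorm_withDensity_rpow hp0 hwm huL.1,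
    eLpNorm_rpow_eq_lintegral hp0] at hlim
  have ig : Integrable (fun x => ‖g x‖ ^ p) m := by
    have := hgL.integrable_norm_rpow (by simpa using hp0) ENNReal.ofReal_ne_top
    rwa [ENNReal.toReal_ofReal hp0.le] at this
  have iu : Integrable (fun x => |u x| ^ p) m := by
    have := huL.integrable_norm_rpow (by simpa using hp0) ENNReal.ofReal_ne_top
    rwa [ENNReal.toReal_ofReal hp0.le] at this
  have hfin : ∫⁻ x, ENNReal.ofReal (w x * |u x| ^ p) ∂m ≠ ⊤ := by
    refine ne_top_of_le_ne_top ?_ hlim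
    rw [← ofReal_integral_eq_lintegral_ofReal ig (ae_of_all _ fun x => by positivity)]
    exact ENNReal.ofReal_ne_top
  have hnn : 0 ≤ᵐ[m] fun x => w x * |u x| ^ p :=
    ae_of_all _ fun x => mul_nonneg (hw0 x) (by positivity)
  have ih : Integrable (fun x => w x * |u x| ^ p) m :=
    (lintegral_ofReal_ne_top_iff_integrable
      (hwm.aestronglyMeasurable.mul iu.1) hnn).1 hfin
  have e : ∀ x, |u x| ^ p / d x ^ p = (hardyConst p)⁻¹ * (w x * |u x| ^ p - c * |u x| ^ p) := by
    intro x
    have : w x * |u x| ^ p - c * |u x| ^ p = hardyConst p * (|u x| ^ p / d x ^ p) := by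
      rw [hw]; ring
    rw [this, inv_mul_cancel_left₀ hC.ne']
  have iq : Integrable (fun x => |u x| ^ p / d x ^ p) m := by
    simp_rw [e]
    exact (ih.sub (iu.const_mul c)).const_mul _
  refine ⟨iq, ?_⟩
  rw [← integral_const_mul, ← integral_const_mul, ← integral_add (iq.const_mul _) (iu.const_mul _)]
  have e2 : ∀ x, hardyConst p * (|u x| ^ p / d x ^ p) + c * |u x| ^ p = w x * |u x| ^ p :=
    fun x => by rw [hw]; ring
  simp_rw [e2]
  rw [← ofReal_integral_eq_lintegral_ofReal ig (ae_of_all _ fun x => by positivity),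
      ← ofReal_integral_eq_lintegral_ofReal ih hnn] at hlim
  exact (ENNReal.ofReal_le_ofReal_iff (integral_nonneg fun x => by positivity)).1 hlim

end Density

/-! ### Blow-up at a lowest boundary point -/

section TangentHyperplane

variable {n : ℕ} {Ω : Set (Euc n)}

/-- The boundary point of `Ω` lowest in the `i`-th coordinate: `Ω` lies above it, and every compact
subset of the upper half-space fits into `Ω` after scaling and translation to that point. -/
lemma exists_blowup_point (hne : Ω.Nonempty) (hopen : IsOpen Ω) (hbdd : Bornology.IsBounded Ω)
    (hC2 : HasC2Boundary Ω) (i : Fin n) :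
    ∃ y : Euc n, (∀ x ∈ Ω, 0 < (x - y) i) ∧
      ∀ K : Set (Euc n), IsCompact K → (∀ x ∈ K, 0 < x i) → ∃ r : ℝ, 0 < r ∧ ∀ k ∈ K, y + r • k ∈ Ω := by
  have hcomp : IsCompact (closure Ω) := hbdd.isCompact_closure
  obtain ⟨y, hy, hmin⟩ := hcomp.exists_isMinOn hne.closure
    (f := fun x : Euc n => x i) (by fun_prop)
  set e : Euc n := EuclideanSpace.single i (1 : ℝ) with he
  have hei : e i = 1 := by simp [he]
  -- Strictness comes from openness: a point of `Ω` can be pushed slightly downwards.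
  have habove : ∀ x ∈ Ω, y i < x i := by
    intro x hx
    have ht : Tendsto (fun t : ℝ => x - t • e) (𝓝[>] 0) (𝓝 x) := by
      have : Continuous fun t : ℝ => x - t • e := by fun_prop
      simpa using (this.tendsto 0).mono_left nhdsWithin_le_nhds
    obtain ⟨t, ht1, ht2⟩ := ((ht.eventually (hopen.mem_nhds hx)).and self_mem_nhdsWithin).exists
    have h1 := isMinOn_iff.1 hmin _ (subset_closure ht1)
    simp only [PiLp.sub_apply, PiLp.smul_apply, hei, smul_eq_mul, mul_one] at h1
    have : 0 < t := ht2
    linarith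
  have hyΩ : y ∉ Ω := fun h => lt_irrefl _ (habove y h)
  have hyf : y ∈ frontier Ω := by rw [hopen.frontier_eq]; exact ⟨hy, hyΩ⟩
  obtain ⟨U, ρ, hU, hyU, hρ, hρ', hΩ⟩ := hC2 y hyf
  refine ⟨y, fun x hx => by simpa using habove x hx, fun K hK hKpos => ?_⟩
  have hd : HasFDerivAt ρ (fderiv ℝ ρ y) y :=
    ((hρ.contDiffAt (hU.mem_nhds hyU)).differentiableAt (by norm_num)).hasFDerivAt
  set D := fderiv ℝ ρ y with hD
  have hρy : ρ y = 0 := by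
    refine le_antisymm ?_ (not_lt.1 fun h => hyΩ ((hΩ y hyU).2 h))
    by_contra! h
    have h1 : ∀ᶠ z in 𝓝 y, 0 < ρ z := hd.continuousAt.eventually (lt_mem_nhds h)
    obtain ⟨z, hz, hzΩ⟩ := mem_closure_iff_nhds.1 hy _ (h1.and (hU.mem_nhds hyU))
    exact lt_asymm hz.1 ((hΩ z hz.2).1 hzΩ)
  -- Directions that do not go up never enter `Ω`, so `ρ` cannot decrease along them. Hence `D`
  -- kills horizontal vectors and, being nonzero, is negative on `e`.
  have hnonneg : ∀ v : Euc n, v i ≤ 0 → 0 ≤ D v := by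
    intro v hv
    have h1 := (hd.hasLineDerivAt v).tendsto_slope_zero_right
    refine ge_of_tendsto h1 ?_
    have ht : Tendsto (fun t : ℝ => y + t • v) (𝓝[>] 0) (𝓝 y) := by
      have : Continuous fun t : ℝ => y + t • v := by fun_prop
      simpa using (this.tendsto 0).mono_left nhdsWithin_le_nhds
    filter_upwards [ht.eventually (hU.mem_nhds hyU), self_mem_nhdsWithin] with t ht1 ht2
    have ht0 : 0 < t := ht2
    rw [hρy, sub_zero]
    refine smul_nonneg (inv_pos.2 ht0).le (not_lt.1 fun h => ?_)
    have := habove _ ((hΩ _ ht1).2 h)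
    simp only [PiLp.add_apply, PiLp.smul_apply, smul_eq_mul] at this
    nlinarith
  have hDv : ∀ v : Euc n, D v = v i * D e := by
    intro v
    have h1 := hnonneg (v - v i • e) (by simp [hei])
    have h2 := hnonneg (-(v - v i • e)) (by simp [hei])
    rw [map_neg] at h2
    have h3 : D (v - v i • e) = 0 := by linarith
    rw [map_sub, map_smul, smul_eq_mul] at h3
    linarith
  have hDe : D e < 0 := by
    have h1 := hnonneg (-e) (by simp [hei])
    rw [map_neg] at h1
    refine lt_of_le_of_ne (by linarith) fun h => hρ' y hyU ?_
    ext v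
    rw [hDv, h]; simp
  obtain ⟨m, hm, hKm⟩ := hK.exists_forall_le' (f := fun x : Euc n => x i) (by fun_prop) hKpos
  obtain ⟨M, hM, hKM⟩ := hK.isBounded.exists_pos_norm_le
  -- With `m` the least height and `M` a norm bound on `K`, the linear term at `r • k` is at most `r
  -- m D e < 0`; this tolerance keeps the Taylor error below half its size.
  have hc : 0 < -D e * m / (2 * M) := by
    have := mul_pos (neg_pos.2 hDe) hm
    positivity
  obtain ⟨δ, hδ, hball⟩ := Metric.eventually_nhds_iff.1
    ((hd.isLittleO.def hc).and (hU.mem_nhds hyU))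
  refine ⟨δ / (2 * M), by positivity, fun k hk => ?_⟩
  set r := δ / (2 * M) with hr
  have hr0 : 0 < r := by positivity
  have hrk : r * ‖k‖ ≤ r * M := mul_le_mul_of_nonneg_left (hKM k hk) hr0.le
  have hrM : r * M = δ / 2 := by rw [hr]; field_simp
  obtain ⟨h1, h2⟩ := hball (y := y + r • k) (by
    rw [dist_eq_norm, add_sub_cancel_left, norm_smul, Real.norm_of_nonneg hr0.le]; linarith)
  refine (hΩ _ h2).2 ?_
  rw [hρy, add_sub_cancel_left, sub_zero, norm_smul, Real.norm_of_nonneg hr0.le, map_smul, hDv,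
    smul_eq_mul, Real.norm_eq_abs] at h1
  have h3 := (le_abs_self _).trans h1
  have h4 : -D e * m / (2 * M) * (r * ‖k‖) ≤ -D e * m / (2 * M) * (r * M) :=
    mul_le_mul_of_nonneg_left hrk hc.le
  have h5 : -D e * m / (2 * M) * (r * M) = r * (-D e * m) / 2 := by field_simp
  have h6 : r * (m * -D e) ≤ r * (k i * -D e) :=
    mul_le_mul_of_nonneg_left (mul_le_mul_of_nonneg_right (hKm k hk) (by linarith)) hr0.le
  have h7 : 0 < r * (m * -D e) := mul_pos hr0 (mul_pos hm (by linarith))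
  linarith

lemma boundaryDist_le_coord (hopen : IsOpen Ω) (hu : Ω ≠ univ) {i : Fin n} {y : Euc n}
    (h : ∀ x ∈ Ω, 0 < (x - y) i) {x : Euc n} (hx : x ∈ Ω) : boundaryDist Ω x ≤ (x - y) i := by
  by_contra! hlt
  have hball := ball_boundaryDist_subset hopen hu hx
  have hmem : x - (x - y) i • EuclideanSpace.single i (1 : ℝ) ∈ Ω := by
    apply hball
    rw [mem_ball, dist_eq_norm, sub_sub_cancel_left, norm_neg, norm_smul,
      Real.norm_of_nonneg (h x hx).le]
    simpa using hlt
  have := h _ hmem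
  simp at this

end TangentHyperplane

/-! ### From the domain to the half-space -/

section HalfSpace

variable {n : ℕ} {Ω : Set (Euc n)} {p : ℝ}

/-- A Hardy inequality on `Ω` passes to the half-space tangent to `Ω`. -/
lemma hardy_halfSpace_of_hardy (hn : 1 ≤ n) (hp : 1 < p) (hne : Ω.Nonempty) (hopen : IsOpen Ω)
    (hbdd : Bornology.IsBounded Ω) (hC2 : HasC2Boundary Ω) (i : Fin n) {K : ℝ} (hK : 0 ≤ K)
    (h : ∀ ψ, IsTestFunction Ω ψ →
      K * (∫ x in Ω, |ψ x| ^ p / boundaryDist Ω x ^ p) ≤ ∫ x in Ω, ‖gradient ψ x‖ ^ p)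
    {φ : Euc n → ℝ} (hφ : IsTestFunction {x : Euc n | 0 < x i} φ) :
    K * (∫ x, |φ x| ^ p / (x i) ^ p) ≤ ∫ x, ‖gradient φ x‖ ^ p := by
  have hp0 : 0 < p := by linarith
  have hu := ne_univ_of_isBounded hn hbdd
  obtain ⟨y, hy, hblow⟩ := exists_blowup_point hne hopen hbdd hC2 i
  obtain ⟨r, hr, hrK⟩ := hblow _ hφ.2.1.isCompact fun x hx => hφ.2.2 hx
  set T : Euc n → Euc n := fun x => r⁻¹ • (x - y) with hT
  have hTinv : ∀ x, y + r • T x = x := fun x => by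
    rw [hT]; simp only; rw [smul_inv_smul₀ hr.ne']; abel
  set ψ : Euc n → ℝ := fun x => φ (T x) with hψ
  have hsub : tsupport ψ ⊆ (fun k => y + r • k) '' tsupport φ := by
    refine closure_minimal (fun x hx => ⟨T x, subset_tsupport _ hx, hTinv x⟩) ?_
    exact (hφ.2.1.isCompact.image (by fun_prop)).isClosed
  have hψtest : IsTestFunction Ω ψ := by
    refine ⟨hφ.1.comp (by rw [hT]; fun_prop), ?_, ?_⟩
    · exact (hφ.2.1.isCompact.image (by fun_prop)).of_isClosed_subset (isClosed_tsupport _) hsub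
    · rintro x hx
      obtain ⟨k, hk, rfl⟩ := hsub hx
      exact hrK k hk
  have hgrad : ∀ x, ‖gradient ψ x‖ = r⁻¹ * ‖gradient φ (T x)‖ := by
    intro x
    have hTd : HasFDerivAt T (r⁻¹ • ContinuousLinearMap.id ℝ (Euc n)) x :=
      ((hasFDerivAt_id x).sub_const y).const_smul r⁻¹
    have h1 := ((hφ.1.differentiable (by simp) (T x)).hasFDerivAt.comp x hTd).fderiv
    have h2 : fderiv ℝ ψ x = r⁻¹ • fderiv ℝ φ (T x) := by
      refine h1.trans ?_
      ext v; simp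
    rw [norm_gradient, norm_gradient, h2, norm_smul, Real.norm_of_nonneg (by positivity)]
  have hchange : ∀ f : Euc n → ℝ, ∫ x, f (T x) = r ^ n * ∫ x, f x := by
    intro f
    rw [hT, integral_sub_right_eq_self (fun x => f (r⁻¹ • x)) y,
      Measure.integral_comp_inv_smul_of_nonneg _ _ hr.le]
    simp
  have hrp : 0 < r⁻¹ ^ p := by positivity
  have e1 : ∫ x in Ω, ‖gradient ψ x‖ ^ p = r⁻¹ ^ p * (r ^ n * ∫ x, ‖gradient φ x‖ ^ p) := by
    rw [setIntegral_eq_integral_of_forall_compl_eq_zero fun x hx => by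
      rw [hψtest.gradient_eq_zero hx, norm_zero, Real.zero_rpow hp0.ne'],
      ← hchange, ← integral_const_mul]
    congr 1; ext x
    rw [hgrad, Real.mul_rpow (by positivity) (norm_nonneg _)]
  have hcoord : ∀ x, (x - y) i = r * T x i := fun x => by
    simp [hT, hr.ne']
  -- `Ω` lies above the hyperplane through `y`, so its boundary distance is at most the height and
  -- the Hardy term can only grow. The factor `r⁻¹ ^ p * r ^ n` also appears for the gradient and
  -- cancels.
  have e2 : r⁻¹ ^ p * (r ^ n * ∫ x, |φ x| ^ p / (x i) ^ p) ≤
      ∫ x in Ω, |ψ x| ^ p / boundaryDist Ω x ^ p := by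
    have e3 : r⁻¹ ^ p * (r ^ n * ∫ x, |φ x| ^ p / (x i) ^ p) =
        ∫ x in Ω, |ψ x| ^ p / ((x - y) i) ^ p := by
      rw [setIntegral_eq_integral_of_forall_compl_eq_zero fun x hx => by
        rw [hψtest.eq_zero hx, abs_zero, Real.zero_rpow hp0.ne', zero_div],
        ← hchange (fun x => |φ x| ^ p / (x i) ^ p), ← integral_const_mul]
      congr 1; ext x
      by_cases hx : 0 < T x i
      · rw [hcoord, Real.mul_rpow hr.le hx.le, Real.inv_rpow hr.le]
        have : 0 < r ^ p := by positivity
        field_simp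
        rfl
      · have : φ (T x) = 0 := hφ.eq_zero hx
        simp [hψ, this, Real.zero_rpow hp0.ne']
    rw [e3]
    refine setIntegral_mono_on
      (hψtest.integrable_abs_rpow_div hp0 (by fun_prop) hy).integrableOn
      (hψtest.integrable_abs_rpow_div hp0 (lipschitzWith_boundaryDist Ω).continuous
        fun x hx => boundaryDist_pos hopen hu hx).integrableOn hopen.measurableSet fun x hx => ?_
    have hpos := boundaryDist_pos hopen hu hx
    exact div_le_div_of_nonneg_left (by positivity) (Real.rpow_pos_of_pos hpos _)
      (Real.rpow_le_rpow hpos.le (boundaryDist_le_coord hopen hu hy hx) hp0.le)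
  have h3 := (mul_le_mul_of_nonneg_left e2 hK).trans (h ψ hψtest)
  rw [e1] at h3
  have hrn : 0 < r⁻¹ ^ p * r ^ n := by positivity
  refine le_of_mul_le_mul_left ?_ hrn
  linarith

end HalfSpace

/-! ### Norms of dilations and products -/

section LpNorm

/-- Integrability is not needed: if the integral diverges, both sides take the default value 0. -/
lemma lpNorm_rpow {α : Type*} [MeasurableSpace α] {E : Type*} [NormedAddCommGroup E]
    {μ : Measure α} {p : ℝ} (hp : 0 < p) {f : α → E} (hf : AEStronglyMeasurable f μ) :
    lpNorm f (ENNReal.ofReal p) μ ^ p = ∫ x, ‖f x‖ ^ p ∂μ := by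
  rw [lpNorm_eq_integral_norm_rpow_toReal (by simpa using hp) ENNReal.ofReal_ne_top hf,
    ENNReal.toReal_ofReal hp.le, ← Real.rpow_mul (integral_nonneg fun x => by positivity),
    inv_mul_cancel₀ hp.ne', Real.rpow_one]

lemma lpNorm_comp_mul_left {p ε : ℝ} (hp : 0 < p) (hε : 0 < ε) {f : ℝ → ℝ} (hf : Continuous f) :
    lpNorm (fun x => f (ε * x)) (ENNReal.ofReal p) volume
      = (ε⁻¹) ^ (p⁻¹) * lpNorm f (ENNReal.ofReal p) volume := by
  have hc : Continuous fun x => f (ε * x) := by fun_prop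
  rw [← Real.rpow_left_inj lpNorm_nonneg (mul_nonneg (by positivity) lpNorm_nonneg) hp.ne',
    lpNorm_rpow hp hc.aestronglyMeasurable, Real.mul_rpow (by positivity) lpNorm_nonneg,
    ← Real.rpow_mul (by positivity), inv_mul_cancel₀ hp.ne', Real.rpow_one,
    lpNorm_rpow hp hf.aestronglyMeasurable,
    Measure.integral_comp_mul_left (fun x => ‖f x‖ ^ p), abs_of_pos (by positivity), smul_eq_mul]

variable {n : ℕ}

lemma integral_euclidean_prod (F : Fin n → ℝ → ℝ) :
    ∫ x : Euc n, ∏ j, F j (x j) = ∏ j, ∫ t, F j t := by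
  rw [← integral_fintype_prod_volume_eq_prod, ← (PiLp.volume_preserving_toLp (Fin n)).integral_comp
    (MeasurableEquiv.toLp 2 (Fin n → ℝ)).measurableEmbedding]

lemma lpNorm_euclidean_prod {p : ℝ} (hp : 0 < p) {f : Fin n → ℝ → ℝ} (hf : ∀ j, Measurable (f j)) :
    lpNorm (fun x : Euc n => ∏ j, f j (x j)) (ENNReal.ofReal p) volume
      = ∏ j, lpNorm (f j) (ENNReal.ofReal p) volume := by
  have hm : Measurable fun x : Euc n => ∏ j, f j (x j) :=
    Finset.measurable_prod _ fun j _ => (hf j).comp (by fun_prop)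
  rw [← Real.rpow_left_inj lpNorm_nonneg (Finset.prod_nonneg fun _ _ => lpNorm_nonneg) hp.ne',
    lpNorm_rpow hp hm.aestronglyMeasurable,
    ← Real.finsetProd_rpow _ _ fun _ _ => lpNorm_nonneg]
  simp_rw [lpNorm_rpow hp (hf _).aestronglyMeasurable]
  rw [← integral_euclidean_prod]
  congr 1; ext x
  rw [norm_prod, Real.finsetProd_rpow _ _ fun _ _ => norm_nonneg _]

lemma hasCompactSupport_euclidean_prod {f : Fin n → ℝ → ℝ} (hf : ∀ j, HasCompactSupport (f j)) :
    HasCompactSupport fun x : Euc n => ∏ j, f j (x j) := by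
  have hK : IsCompact (univ.pi fun j => tsupport (f j)) := isCompact_univ_pi fun j => (hf j).isCompact
  have hK' := hK.image (PiLp.continuous_toLp 2 fun _ : Fin n => ℝ)
  refine hK'.of_isClosed_subset (isClosed_tsupport _) (closure_minimal (fun x hx => ?_) hK'.isClosed)
  refine ⟨x.ofLp, fun j _ => subset_tsupport _ fun h => hx ?_, rfl⟩
  exact Finset.prod_eq_zero (Finset.mem_univ j) h

/-- Triangle inequality on the partial derivatives. This is crude, but it has coefficient 1 on each
of them, and in the application all tangential terms tend to 0. -/
lemma lpNorm_gradient_prod_le {p : ℝ} (hp : 1 < p) {f : Fin n → ℝ → ℝ}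
    (hf : ∀ j, ContDiff ℝ ∞ (f j)) (hfc : ∀ j, HasCompactSupport (f j)) :
    lpNorm (gradient fun x : Euc n => ∏ j, f j (x j)) (ENNReal.ofReal p) volume
      ≤ ∑ i, ∏ j, lpNorm (if j = i then deriv (f j) else f j) (ENNReal.ofReal p) volume := by
  have hp0 : 0 < p := by linarith
  have hp1 : (1 : ENNReal) ≤ ENNReal.ofReal p := by
    rw [← ENNReal.ofReal_one]; exact ENNReal.ofReal_le_ofReal hp.le
  set h : Fin n → Fin n → ℝ → ℝ := fun i j => if j = i then deriv (f j) else f j with hh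
  have hhc : ∀ i j, Continuous (h i j) := by
    intro i j
    simp only [hh]
    split_ifs
    · exact (hf j).continuous_deriv (by simp)
    · exact (hf j).continuous
  have hhs : ∀ i j, HasCompactSupport (h i j) := by
    intro i j
    simp only [hh]
    split_ifs
    · exact (hfc j).deriv
    · exact hfc j
  set g : Fin n → Euc n → ℝ := fun i x => ∏ j, h i j (x j) with hg
  have hgm : ∀ i, MemLp (fun x => ‖g i x‖) (ENNReal.ofReal p) volume := fun i =>
    (Continuous.memLp_of_hasCompactSupport (by fun_prop)
      (hasCompactSupport_euclidean_prod (hhs i))).norm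
  have hbound : ∀ x, ‖gradient (fun x : Euc n => ∏ j, f j (x j)) x‖ ≤ ∑ i, ‖g i x‖ := by
    intro x
    have hd : HasFDerivAt (fun x : Euc n => ∏ j, f j (x j))
        (∑ i, (∏ j ∈ Finset.univ.erase i, f j (x j)) •
          (deriv (f i) (x i) • (EuclideanSpace.proj i : Euc n →L[ℝ] ℝ))) x := by
      refine HasFDerivAt.finsetProd (u := Finset.univ) (g := fun j (x : Euc n) => f j (x j)) fun i _ => ?_
      exact (((hf i).differentiable (by simp) (x i)).hasDerivAt).comp_hasFDerivAt x
        (EuclideanSpace.proj i : Euc n →L[ℝ] ℝ).hasFDerivAt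
    rw [norm_gradient, hd.fderiv]
    refine (norm_sum_le _ _).trans (Finset.sum_le_sum fun i _ => ?_)
    have hproj : ‖(EuclideanSpace.proj i : Euc n →L[ℝ] ℝ)‖ ≤ 1 :=
      ContinuousLinearMap.opNorm_le_bound _ zero_le_one fun v => by
        simpa using PiLp.norm_apply_le v i
    have hgi : g i x = (∏ j ∈ Finset.univ.erase i, f j (x j)) * deriv (f i) (x i) := by
      rw [hg]; simp only
      rw [← Finset.prod_erase_mul _ _ (Finset.mem_univ i)]
      congr 1
      · refine Finset.prod_congr rfl fun j hj => ?_
        simp [hh, Finset.ne_of_mem_erase hj]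
      · simp [hh]
    rw [smul_smul, norm_smul, ← hgi]
    exact mul_le_of_le_one_right (norm_nonneg _) hproj
  calc lpNorm (gradient fun x : Euc n => ∏ j, f j (x j)) (ENNReal.ofReal p) volume
      ≤ lpNorm (∑ i, fun x => ‖g i x‖) (ENNReal.ofReal p) volume :=
        lpNorm_mono_real (memLp_finsetSum' _ fun i _ => hgm i) fun x => by
          simpa using hbound x
    _ ≤ ∑ i, lpNorm (fun x => ‖g i x‖) (ENNReal.ofReal p) volume :=
        lpNorm_sum_le (fun i _ => hgm i) hp1
    _ = _ := Finset.sum_congr rfl fun i _ => by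
        have hc : Continuous (g i) := by simp only [hg]; fun_prop
        have e := lpNorm_norm (μ := volume) hc.aestronglyMeasurable (ENNReal.ofReal p)
        rw [e]
        exact lpNorm_euclidean_prod hp0 fun j => (hhc i j).measurable

end LpNorm

/-! ### Reduction to the half-line and optimality there -/

section OneDimensional

variable {n : ℕ} {p : ℝ}

/-- A Hardy inequality on a half-space passes to the half-line. -/
lemma hardy_halfLine_of_halfSpace (hp : 1 < p) (i : Fin n) {K : ℝ} (hK : 0 ≤ K)
    (h : ∀ φ : Euc n → ℝ, IsTestFunction {x : Euc n | 0 < x i} φ →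
      K * (∫ x, |φ x| ^ p / (x i) ^ p) ≤ ∫ x, ‖gradient φ x‖ ^ p)
    {β : ℝ → ℝ} (hβ : ContDiff ℝ ∞ β) (hβc : HasCompactSupport β)
    (hβ0 : 0 < lpNorm β (ENNReal.ofReal p) volume)
    {χ : ℝ → ℝ} (hχ : ContDiff ℝ ∞ χ) (hχc : HasCompactSupport χ) (hχs : tsupport χ ⊆ Ioi 0) :
    K ^ p⁻¹ * lpNorm (fun t => χ t / t) (ENNReal.ofReal p) volume
      ≤ lpNorm (deriv χ) (ENNReal.ofReal p) volume := by
  have hp0 : 0 < p := by linarith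
  set q := ENNReal.ofReal p with hq
  set N : (ℝ → ℝ) → ℝ := fun f => lpNorm f q volume with hN
  set C := ((Finset.univ.erase i).card : ℝ) * (N χ * (N (deriv β) / N β)) with hC
  have key : ∀ ε : ℝ, 0 < ε → K ^ p⁻¹ * N (fun t => χ t / t) ≤ N (deriv χ) + ε * C := by
    intro ε hε
    set b : ℝ → ℝ := fun t => β (ε * t) with hb
    have hbs : ContDiff ℝ ∞ b := hβ.comp (by fun_prop)
    have hbc : HasCompactSupport b :=
      hβc.comp_homeomorph (Homeomorph.mulLeft₀ ε hε.ne')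
    have hbd : deriv b = fun t => ε * deriv β (ε * t) := by
      ext t; rw [hb, deriv_comp_mul_left]; simp
    have hbN : N b = (ε⁻¹) ^ (p⁻¹) * N β := lpNorm_comp_mul_left hp0 hε hβ.continuous
    have hbdN : N (deriv b) = ε * ((ε⁻¹) ^ (p⁻¹) * N (deriv β)) := by
      have hcd := hβ.continuous_deriv (by simp)
      rw [hbd]
      have e1 : N (fun t => ε * deriv β (ε * t)) = ε * N (fun t => deriv β (ε * t)) := by
        have := lpNorm_const_smul (p := q) ε (fun t => deriv β (ε * t)) (volume : Measure ℝ)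
        rw [hN]
        simp only
        rw [Real.nnnorm_of_nonneg hε.le] at this
        exact this
      rw [e1]
      congr 1
      exact lpNorm_comp_mul_left hp0 hε hcd
    have hεp : 0 < (ε⁻¹) ^ (p⁻¹) := by positivity
    have hbpos : 0 < N b := by rw [hbN]; exact mul_pos hεp hβ0
    -- Relative to its own norm, the stretched cutoff has a derivative of size `ε`; every tangential
    -- term therefore carries a factor `ε` after division by the common product `P`.
    have hratio : N (deriv b) = ε * (N (deriv β) / N β) * N b := by
      rw [hbN, hbdN]
      have : N β ≠ 0 := hβ0.ne'
      field_simp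
    set f : Fin n → ℝ → ℝ := fun j => if j = i then χ else b with hf
    have hfi : f i = χ := by simp [hf]
    have hfj : ∀ j, j ≠ i → f j = b := fun j hj => by simp [hf, hj]
    have hfs : ∀ j, ContDiff ℝ ∞ (f j) := fun j => by
      simp only [hf]; split_ifs; exacts [hχ, hbs]
    have hfc : ∀ j, HasCompactSupport (f j) := fun j => by
      simp only [hf]; split_ifs; exacts [hχc, hbc]
    set φ : Euc n → ℝ := fun x => ∏ j, f j (x j) with hφ
    have hφtest : IsTestFunction {x : Euc n | 0 < x i} φ := by
      refine ⟨contDiff_prod fun j _ => (hfs j).comp (by fun_prop),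
        hasCompactSupport_euclidean_prod hfc, ?_⟩
      have hcl : IsClosed {x : Euc n | x i ∈ tsupport χ} :=
        (isClosed_tsupport χ).preimage (by fun_prop)
      refine (closure_minimal (fun x hx => ?_) hcl).trans fun x hx => hχs hx
      refine subset_tsupport _ fun h0 => hx ?_
      exact Finset.prod_eq_zero (Finset.mem_univ i) (by rw [hfi]; exact h0)
    have h1 := h φ hφtest
    set f' : Fin n → ℝ → ℝ := fun j => if j = i then (fun t => χ t / t) else b with hf'
    have hf'm : ∀ j, Measurable (f' j) := fun j => by
      simp only [hf']
      split_ifs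
      · exact hχ.continuous.measurable.div measurable_id
      · exact hbs.continuous.measurable
    have hpe : ∀ F : Fin n → ℝ → ℝ, ∏ j, N (F j) = N (F i) * ∏ j ∈ Finset.univ.erase i, N (F j) :=
      fun F => (Finset.mul_prod_erase _ _ (Finset.mem_univ i)).symm
    have e2 : ∫ x, |φ x| ^ p / (x i) ^ p = (∏ j, N (f' j)) ^ p := by
      have hm : Measurable fun x : Euc n => ∏ j, f' j (x j) :=
        Finset.measurable_prod _ fun j _ => (hf'm j).comp (by fun_prop)
      rw [← lpNorm_euclidean_prod hp0 hf'm, lpNorm_rpow hp0 hm.aestronglyMeasurable]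
      congr 1; ext x
      have e3 : φ x = χ (x i) * ∏ j ∈ Finset.univ.erase i, b (x j) := by
        rw [hφ]; simp only
        rw [← Finset.mul_prod_erase _ _ (Finset.mem_univ i), hfi]
        congr 1
        exact Finset.prod_congr rfl fun j hj => by rw [hfj j (Finset.ne_of_mem_erase hj)]
      have e4 : ∏ j, f' j (x j) = χ (x i) / x i * ∏ j ∈ Finset.univ.erase i, b (x j) := by
        rw [← Finset.mul_prod_erase _ _ (Finset.mem_univ i)]
        congr 1
        · simp [hf']
        · exact Finset.prod_congr rfl fun j hj => by simp [hf', Finset.ne_of_mem_erase hj]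
      by_cases hx : 0 < x i
      · have : ∏ j, f' j (x j) = φ x / x i := by rw [e3, e4]; ring
        rw [this, Real.norm_eq_abs, abs_div, abs_of_pos hx, Real.div_rpow (abs_nonneg _) hx.le]
      · have h0 : χ (x i) = 0 := image_eq_zero_of_notMem_tsupport fun hh => hx (hχs hh)
        simp [e3, e4, h0, Real.zero_rpow hp0.ne']
    have e5 : ∫ x, ‖gradient φ x‖ ^ p = lpNorm (gradient φ) q volume ^ p :=
      (lpNorm_rpow hp0 hφtest.continuous_gradient.aestronglyMeasurable).symm
    have hprod0 : 0 ≤ ∏ j, N (f' j) := Finset.prod_nonneg fun _ _ => lpNorm_nonneg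
    rw [e2, e5] at h1
    have h2 : K ^ p⁻¹ * ∏ j, N (f' j) ≤ lpNorm (gradient φ) q volume := by
      rw [← Real.rpow_le_rpow_iff (by positivity) lpNorm_nonneg hp0,
        Real.mul_rpow (by positivity) hprod0, ← Real.rpow_mul hK, inv_mul_cancel₀ hp0.ne',
        Real.rpow_one]
      exact h1
    have h3 := h2.trans (lpNorm_gradient_prod_le hp hfs hfc)
    set P := ∏ j ∈ Finset.univ.erase i, N b with hP
    have hPpos : 0 < P := Finset.prod_pos fun _ _ => hbpos
    have e6 : ∏ j, N (f' j) = N (fun t => χ t / t) * P := by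
      rw [hpe]
      congr 1
      · simp [hf']
      · exact Finset.prod_congr rfl fun j hj => by simp [hf', Finset.ne_of_mem_erase hj]
    have e7 : ∏ j, N (if j = i then deriv (f j) else f j) = N (deriv χ) * P := by
      rw [hpe fun j => if j = i then deriv (f j) else f j]
      congr 1
      · simp [hfi]
      · exact Finset.prod_congr rfl fun j hj => by
          have := Finset.ne_of_mem_erase hj
          rw [if_neg this, hfj j this]
    have e8 : ∀ k ∈ Finset.univ.erase i, ∏ j, N (if j = k then deriv (f j) else f j)
        = ε * (N χ * (N (deriv β) / N β)) * P := by
      intro k hk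
      have hki := Finset.ne_of_mem_erase hk
      rw [hpe fun j => if j = k then deriv (f j) else f j, hP,
        ← Finset.mul_prod_erase _ _ hk, ← Finset.mul_prod_erase _ (fun _ => N b) hk]
      have e9 : ∏ j ∈ (Finset.univ.erase i).erase k, N (if j = k then deriv (f j) else f j)
          = ∏ j ∈ (Finset.univ.erase i).erase k, N b :=
        Finset.prod_congr rfl fun j hj => by
          rw [if_neg (Finset.ne_of_mem_erase hj),
            hfj j (Finset.ne_of_mem_erase (Finset.mem_of_mem_erase hj))]
      rw [e9, if_neg hki.symm, if_pos rfl, hfi, hfj k hki, hratio]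
      ring
    have h4 : K ^ p⁻¹ * ∏ j, N (f' j) ≤
        ∑ k, ∏ j, N (if j = k then deriv (f j) else f j) := h3
    rw [e6, ← Finset.add_sum_erase _ _ (Finset.mem_univ i), e7, Finset.sum_congr rfl e8,
      Finset.sum_const, nsmul_eq_mul] at h4
    refine le_of_mul_le_mul_right ?_ hPpos
    rw [hC]
    linarith
  have hlim : Tendsto (fun ε : ℝ => N (deriv χ) + ε * C) (𝓝[>] 0) (𝓝 (N (deriv χ))) := by
    have : Continuous fun ε : ℝ => N (deriv χ) + ε * C := by fun_prop
    simpa using (this.tendsto 0).mono_left nhdsWithin_le_nhds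
  exact ge_of_tendsto hlim (by filter_upwards [self_mem_nhdsWithin] with ε hε using key ε hε)

lemma integral_eq_integral_exp {F : ℝ → ℝ} (hF : ∀ t ≤ 0, F t = 0) :
    ∫ t, F t = ∫ s, Real.exp s * F (Real.exp s) := by
  have h := integral_image_eq_integral_abs_deriv_smul (s := univ) (f := Real.exp) MeasurableSet.univ
    (fun x _ => (Real.hasDerivAt_exp x).hasDerivWithinAt) Real.exp_injective.injOn F
  rw [image_univ, Real.range_exp, setIntegral_univ] at h
  rw [setIntegral_eq_integral_of_forall_compl_eq_zero (s := Ioi 0) fun x hx => hF x (not_lt.1 hx)] at h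
  simpa [abs_of_pos (Real.exp_pos _)] using h

/-- The functions `t ^ c η(ε log t)`, `c = (p - 1) / p`, show that the Hardy constant on the
half-line is optimal. -/
lemma le_hardyConst_of_halfLine (hp : 1 < p) {κ : ℝ}
    (h : ∀ χ : ℝ → ℝ, ContDiff ℝ ∞ χ → HasCompactSupport χ → tsupport χ ⊆ Ioi 0 →
      κ * lpNorm (fun t => χ t / t) (ENNReal.ofReal p) volume
        ≤ lpNorm (deriv χ) (ENNReal.ofReal p) volume)
    {η : ℝ → ℝ} (hη : ContDiff ℝ ∞ η) (hηc : HasCompactSupport η)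
    (hη0 : 0 < lpNorm η (ENNReal.ofReal p) volume) :
    κ ≤ (p - 1) / p := by
  have hp0 : 0 < p := by linarith
  have hp1 : (1 : ENNReal) ≤ ENNReal.ofReal p := by
    rw [← ENNReal.ofReal_one]; exact ENNReal.ofReal_le_ofReal hp.le
  set c := (p - 1) / p with hc
  have hcpos : 0 < c := div_pos (by linarith) hp0
  have hcp : c * p = p - 1 := by rw [hc]; field_simp
  -- The choice of `c` makes `t^((c-1)p) dt` equal to `ds` under `t = exp s`, so both norms become
  -- unweighted norms on the line.
  have hone : ∀ s, Real.exp s * Real.exp s ^ ((c - 1) * p) = 1 := fun s => by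
    rw [show (c - 1) * p = -1 by linarith, Real.rpow_neg_one, mul_inv_cancel₀ (Real.exp_pos s).ne']
  set q := ENNReal.ofReal p with hq
  set N : (ℝ → ℝ) → ℝ := fun f => lpNorm f q volume with hN
  have hηd : Continuous (deriv η) := hη.continuous_deriv (by simp)
  have key : ∀ ε : ℝ, 0 < ε → κ * N η ≤ c * N η + ε * N (deriv η) := by
    intro ε hε
    obtain ⟨M, hM, hMb⟩ := hηc.isCompact.isBounded.exists_pos_norm_le
    set χ : ℝ → ℝ := fun t => if 0 < t then t ^ c * η (ε * Real.log t) else 0 with hχ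
    have hpos : ∀ t, 0 < t → χ t = t ^ c * η (ε * Real.log t) := fun t ht => if_pos ht
    have hsupp : Function.support χ ⊆ Icc (Real.exp (-(M / ε))) (Real.exp (M / ε)) := by
      intro t ht
      have ht0 : 0 < t := by
        by_contra h0; exact ht (if_neg h0)
      have h1 : η (ε * Real.log t) ≠ 0 := fun h0 => ht (by rw [hpos t ht0, h0, mul_zero])
      have h2 := hMb _ (subset_tsupport _ h1)
      rw [Real.norm_eq_abs, abs_mul, abs_of_pos hε] at h2
      have h3 : |Real.log t| ≤ M / ε := by rw [le_div_iff₀ hε]; linarith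
      rw [abs_le] at h3
      exact ⟨(Real.le_log_iff_exp_le ht0).1 h3.1, (Real.log_le_iff_le_exp ht0).1 h3.2⟩
    have hts : tsupport χ ⊆ Icc (Real.exp (-(M / ε))) (Real.exp (M / ε)) :=
      closure_minimal hsupp isClosed_Icc
    have hts0 : tsupport χ ⊆ Ioi 0 := fun t ht => (Real.exp_pos _).trans_le (hts ht).1
    have hχc : HasCompactSupport χ := isCompact_Icc.of_isClosed_subset (isClosed_tsupport _) hts
    have hev : ∀ t, 0 < t → χ =ᶠ[𝓝 t] fun t => t ^ c * η (ε * Real.log t) := fun t ht => by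
      filter_upwards [lt_mem_nhds ht] with s hs using hpos s hs
    have hχs : ContDiff ℝ ∞ χ := by
      rw [contDiff_iff_contDiffAt]
      intro t
      by_cases ht : 0 < t
      · refine ContDiffAt.congr_of_eventuallyEq ?_ (hev t ht)
        exact (Real.contDiffAt_rpow_const_of_ne ht.ne').mul
          (hη.contDiffAt.comp t (contDiffAt_const.mul (Real.contDiffAt_log.2 ht.ne')))
      · have : χ =ᶠ[𝓝 t] fun _ => 0 :=
          notMem_tsupport_iff_eventuallyEq.1 fun h0 => ht (hts0 h0)
        exact contDiffAt_const.congr_of_eventuallyEq this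
    have hder : ∀ t, 0 < t → deriv χ t =
        t ^ (c - 1) * (c * η (ε * Real.log t) + ε * deriv η (ε * Real.log t)) := by
      intro t ht
      have h1 := Real.hasDerivAt_rpow_const (x := t) (p := c) (Or.inl ht.ne')
      have h2 := (hη.differentiable (by simp) (ε * Real.log t)).hasDerivAt.comp t
        ((Real.hasDerivAt_log ht.ne').const_mul ε)
      have h3 := (h1.mul h2).deriv
      rw [(hev t ht).deriv_eq]
      refine h3.trans ?_
      simp only [Function.comp]
      rw [Real.rpow_sub_one ht.ne']
      field_simp
    have h1 := h χ hχs hχc hts0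
    -- The profile of `deriv χ` in the logarithmic variable; as `ε → 0` only `c * η` survives, and
    -- the common dilation factor cancels.
    set θ : ℝ → ℝ := fun s => c * η s + ε * deriv η s with hθ
    have hθc : Continuous θ := by have := hη.continuous; rw [hθ]; fun_prop
    have e1 : N (fun t => χ t / t) = N (fun s => η (ε * s)) := by
      have hm : AEStronglyMeasurable (fun t => χ t / t) volume :=
        (hχs.continuous.measurable.div measurable_id).aestronglyMeasurable
      have hc1 : Continuous (fun s => η (ε * s)) := hη.continuous.comp (by fun_prop)
      rw [← Real.rpow_left_inj lpNorm_nonneg lpNorm_nonneg hp0.ne', lpNorm_rpow hp0 hm,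
        lpNorm_rpow hp0 hc1.aestronglyMeasurable, integral_eq_integral_exp]
      · congr 1; ext s
        have hes := Real.exp_pos s
        rw [hpos _ hes, Real.log_exp, mul_div_right_comm, norm_mul, Real.mul_rpow (norm_nonneg _)
          (norm_nonneg _), ← mul_assoc, ← Real.rpow_sub_one hes.ne',
          Real.norm_of_nonneg (by positivity), ← Real.rpow_mul hes.le, hone, one_mul]
      · intro t ht
        simp [hχ, not_lt.2 ht, Real.zero_rpow hp0.ne']
    have e2 : N (deriv χ) = N (fun s => θ (ε * s)) := by
      have hc1 : Continuous (fun s => θ (ε * s)) := hθc.comp (by fun_prop)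
      rw [← Real.rpow_left_inj lpNorm_nonneg lpNorm_nonneg hp0.ne',
        lpNorm_rpow hp0 (hχs.continuous_deriv (by simp)).aestronglyMeasurable,
        lpNorm_rpow hp0 hc1.aestronglyMeasurable, integral_eq_integral_exp]
      · congr 1; ext s
        have hes := Real.exp_pos s
        rw [hder _ hes, Real.log_exp, norm_mul, Real.mul_rpow (norm_nonneg _)
          (norm_nonneg _), ← mul_assoc,
          Real.norm_of_nonneg (by positivity), ← Real.rpow_mul hes.le, hone, one_mul]
      · intro t ht
        have : deriv χ t = 0 := by
          have h0 : χ =ᶠ[𝓝 t] fun _ => 0 :=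
            notMem_tsupport_iff_eventuallyEq.1 fun h0 => not_lt.2 ht (hts0 h0)
          rw [h0.deriv_eq]; simp
        simp [this, Real.zero_rpow hp0.ne']
    have e3 : N (fun s => η (ε * s)) = (ε⁻¹) ^ (p⁻¹) * N η :=
      lpNorm_comp_mul_left hp0 hε hη.continuous
    have e4 : N (fun s => θ (ε * s)) = (ε⁻¹) ^ (p⁻¹) * N θ := lpNorm_comp_mul_left hp0 hε hθc
    have h2 : κ * N (fun t => χ t / t) ≤ N (deriv χ) := h1
    rw [e1, e2, e3, e4] at h2
    have hεp : 0 < (ε⁻¹) ^ (p⁻¹) := by positivity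
    have h3 : κ * N η ≤ N θ := le_of_mul_le_mul_left (by linarith) hεp
    refine h3.trans ?_
    have m1 : MemLp η q volume := hη.continuous.memLp_of_hasCompactSupport hηc
    have h4 := lpNorm_add_le (m1.const_smul c) hp1 (g := ε • deriv η)
    rw [lpNorm_const_smul, lpNorm_const_smul, Real.nnnorm_of_nonneg hε.le,
      Real.nnnorm_of_nonneg hcpos.le] at h4
    exact h4
  have hlim : Tendsto (fun ε : ℝ => c * N η + ε * N (deriv η)) (𝓝[>] 0) (𝓝 (c * N η)) := by
    have : Continuous fun ε : ℝ => c * N η + ε * N (deriv η) := by fun_prop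
    simpa using (this.tendsto 0).mono_left nhdsWithin_le_nhds
  have h5 : κ * N η ≤ c * N η :=
    ge_of_tendsto hlim (by filter_upwards [self_mem_nhdsWithin] with ε hε using key ε hε)
  exact le_of_mul_le_mul_right h5 hη0

lemma exists_contDiff_lpNorm_pos (hp : 0 < p) :
    ∃ η : ℝ → ℝ, ContDiff ℝ ∞ η ∧ HasCompactSupport η ∧ 0 < lpNorm η (ENNReal.ofReal p) volume := by
  let f : ContDiffBump (0 : ℝ) := ⟨1, 2, one_pos, one_lt_two⟩
  refine ⟨f, f.contDiff, f.hasCompactSupport, lt_of_le_of_ne lpNorm_nonneg fun h => ?_⟩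
  have hm := f.continuous.memLp_of_hasCompactSupport (p := ENNReal.ofReal p) (μ := volume)
    f.hasCompactSupport
  have h0 := (lpNorm_eq_zero hm (by simpa using hp)).1 h.symm
  have h1 := congrFun ((f.continuous.ae_eq_iff_eq volume continuous_zero).1 h0) 0
  rw [f.one_of_mem_closedBall (by simp [f])] at h1
  simp at h1

end OneDimensional

theorem corollary3p4 {n : ℕ} (hn : 1 ≤ n) {p : ℝ} (hp : 1 < p) {Ω : Set (Euc n)}
    (hne : Ω.Nonempty) (hopen : IsOpen Ω) (hbdd : Bornology.IsBounded Ω)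
    (hconv : Convex ℝ Ω) (hC2 : HasC2Boundary Ω) :
    (∀ (u : Euc n → ℝ) (g : Euc n → Euc n), MemSobolevZero p Ω u → HasWeakGradient Ω u g →
      IntegrableOn (fun x => |u x| ^ p / boundaryDist Ω x ^ p) Ω ∧
      (∫ x in Ω, ‖g x‖ ^ p) ≥
        hardyConst p * (∫ x in Ω, |u x| ^ p / boundaryDist Ω x ^ p)
          + ((p - 1) * hardyConst p / inradius Ω ^ p) * (∫ x in Ω, |u x| ^ p)) ∧
    (∀ K : ℝ,
      (∀ (u : Euc n → ℝ) (g : Euc n → Euc n), MemSobolevZero p Ω u → HasWeakGradient Ω u g →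
        (∫ x in Ω, ‖g x‖ ^ p) ≥ K * (∫ x in Ω, |u x| ^ p / boundaryDist Ω x ^ p)) →
      K ≤ hardyConst p) := by
  refine ⟨fun u g hu hg => hardy_of_memSobolevZero hn hp hopen hbdd hconv hu hg, fun K hK => ?_⟩
  have hp0 : 0 < p := by linarith
  -- The reductions below use `K^(1/p)` and monotonicity in `K ≥ 0`, so nonpositive constants are
  -- settled separately.
  rcases le_or_gt K 0 with h0 | h0
  · exact h0.trans (hardyConst_pos hp).le
  obtain ⟨η, hη, hηc, hη0⟩ := exists_contDiff_lpNorm_pos hp0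
  have h1 := le_hardyConst_of_halfLine hp (κ := K ^ p⁻¹) (fun χ a1 a2 a3 =>
    hardy_halfLine_of_halfSpace hp (⟨0, hn⟩ : Fin n) h0.le (fun φ hφ =>
      hardy_halfSpace_of_hardy hn hp hne hopen hbdd hC2 ⟨0, hn⟩ h0.le
        (fun ψ hψ => hK ψ (gradient ψ) (hψ.memSobolevZero p) hψ.hasWeakGradient) hφ)
      hη hηc hη0 a1 a2 a3) hη hηc hη0
  have h2 := Real.rpow_le_rpow (by positivity) h1 hp0.le
  rwa [← Real.rpow_mul h0.le, inv_mul_cancel₀ hp0.ne', Real.rpow_one] at h2
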